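/- Let $n\ge 4$ and let $\mathbb{R}^{n+1}_1$ be $\mathbb{R}^{n+1}$ with the Minkowski scalar product $\langle\cdot,\cdot\rangle$ of signature $(n,1)$; write $v^2=\langle v,v\rangle$. Let $M$ be a smooth canal space-like hypersurface in $\mathbb{R}^{n+1}_1$ with position vector $Z$: the induced metric $g$ on the $n$-dimensional manifold $M$ is positive definite; $M$ is a one-parameter family of $(n-1)$-dimensional spherical generators, the level sets of a smooth function $s$ on $M$ with $ds\neq 0$ and with image an open interval $J$; and there are a smooth curve $z:J\to\mathbb{R}^{n+1}_1$ (the curve of centers) and a smooth function $R:J\to(0,\infty)$ such that, for every $\sigma\in J$, the generator $\{s=\sigma\}$ lies in the intersection of the space-like hypersphere $(Z-z(\sigma))^2=-R(\sigma)^2$ with a hyperplane, and the normals to $M$ at the points of this generator pass through $z(\sigma)$. Put $t=z'$, $N=-(Z-z)/R$, and equip $M$ with the unit tangent vector field $$\xi=\frac{t-R'N}{\sqrt{(t-R'N)^2}}.$$ Suppose that $M$ is of elliptic type, i.e. the curve of centers is time-like: $z'(\sigma)^2<0$ for all $\sigma\in J$. Then $(M,g,\xi)$ is a Riemannian subprojective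 manifold if and only if $M$ is rotational, i.e. the curve of centers $z$ lies on a straight line. Here $(M,g,\xi)$ is called a Riemannian subprojective manifold if it is of quasi-constant sectional curvatures (the sectional curvature of a 2-plane $E\subset T_pM$ depends only on $p$ and on the angle between $E$ and $\xi_p$) and the vector field $\xi$ is geodesic ($\nabla_\xi\xi=0$, where $\nabla$ is the Levi-Civita connection of $g$). -/

import Mathlib

open scoped Manifold ContDiff

noncomputable section

namespace CanalMinkowski

/-! ### Riemannian geometry in coordinates

A coordinate domain is an open set `U` of `ℝⁿ`; a metric is given by its matrix of
components `g x i j`, a vector field by its component function `ξ`. -/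

/-- Coordinate space `ℝⁿ`. -/
abbrev Coord (n : ℕ) := EuclideanSpace ℝ (Fin n)

/-- The `i`-th coordinate vector. -/
def basisVec {n : ℕ} (i : Fin n) : Coord n := EuclideanSpace.single i 1

/-- The partial derivative `∂ᵢ h` at `x`. -/
def partialD {n : ℕ} (i : Fin n) (h : Coord n → ℝ) (x : Coord n) : ℝ :=
  fderiv ℝ h x (basisVec i)

/-- The scalar product `g(X, Y)` at `x`. -/
def metricAt {n : ℕ} (g : Coord n → Matrix (Fin n) (Fin n) ℝ) (x X Y : Coord n) : ℝ :=
  ∑ i, ∑ j, g x i j * X i * Y j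

/-- The Christoffel symbol `Γᵏᵢⱼ` of the Levi-Civita connection of `g`. -/
def christoffel {n : ℕ} (g : Coord n → Matrix (Fin n) (Fin n) ℝ) (k i j : Fin n)
    (x : Coord n) : ℝ :=
  (1 / 2) * ∑ l, (g x)⁻¹ k l *
    (partialD i (fun y => g y j l) x + partialD j (fun y => g y i l) x
      - partialD l (fun y => g y i j) x)

/-- The component along `∂ₗ` of
`R(∂ᵢ, ∂ⱼ)∂ₖ = ∇ᵢ∇ⱼ∂ₖ - ∇ⱼ∇ᵢ∂ₖ`. -/
def curvatureComp {n : ℕ} (g : Coord n → Matrix (Fin n) (Fin n) ℝ) (l i j k : Fin n)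
    (x : Coord n) : ℝ :=
  partialD i (christoffel g l j k) x - partialD j (christoffel g l i k) x
    + ∑ m, (christoffel g m j k x * christoffel g l i m x
      - christoffel g m i k x * christoffel g l j m x)

/-- The Riemannian curvature tensor `R(X, Y, Z, W) = g(R(X, Y)Z, W)` at `x`. -/
def curvature {n : ℕ} (g : Coord n → Matrix (Fin n) (Fin n) ℝ) (x X Y Z W : Coord n) : ℝ :=
  ∑ i, ∑ j, ∑ k, ∑ l, ∑ m,
    X i * Y j * Z k * W m * g x l m * curvatureComp g l i j k x

/-- The pair `(X, Y)` is orthonormal with respect to `g` at `x`. -/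
def IsOrthonormalPair {n : ℕ} (g : Coord n → Matrix (Fin n) (Fin n) ℝ)
    (x X Y : Coord n) : Prop :=
  metricAt g x X X = 1 ∧ metricAt g x Y Y = 1 ∧ metricAt g x X Y = 0

/-- The angle between the unit vector `v` and the 2-plane with orthonormal basis `(X, Y)`:
its cosine is the length of the orthogonal projection of `v` onto the plane. -/
def planeAngle {n : ℕ} (g : Coord n → Matrix (Fin n) (Fin n) ℝ) (x v X Y : Coord n) : ℝ :=
  Real.arccos (Real.sqrt (metricAt g x v X ^ 2 + metricAt g x v Y ^ 2))

/-- `(U, g, ξ)` is a smooth Riemannian manifold endowed with a smooth unit vector field. -/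
structure IsRiemannianWithUnitField {n : ℕ} (U : Set (Coord n))
    (g : Coord n → Matrix (Fin n) (Fin n) ℝ) (ξ : Coord n → Coord n) : Prop where
  smooth_metric : ∀ i j, ContDiffOn ℝ ∞ (fun x => g x i j) U
  posDef : ∀ x ∈ U, (g x).PosDef
  smooth_field : ContDiffOn ℝ ∞ ξ U
  unit_field : ∀ x ∈ U, metricAt g x (ξ x) (ξ x) = 1

/-- Quasi-constant sectional curvatures: at each point the sectional curvature of a tangent
2-plane depends only on its angle with `ξ`. (For an orthonormal basis `(X, Y)` of the plane the
sectional curvature is `R(X, Y, Y, X)`.) -/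
def IsQuasiConstantCurvature {n : ℕ} (U : Set (Coord n))
    (g : Coord n → Matrix (Fin n) (Fin n) ℝ) (ξ : Coord n → Coord n) : Prop :=
  ∀ x ∈ U, ∃ K : ℝ → ℝ, ∀ X Y : Coord n, IsOrthonormalPair g x X Y →
    curvature g x X Y Y X = K (planeAngle g x (ξ x) X Y)

/-- The vector field `ξ` is geodesic: `∇_ξ ξ = 0`. -/
def IsGeodesicField {n : ℕ} (U : Set (Coord n))
    (g : Coord n → Matrix (Fin n) (Fin n) ℝ) (ξ : Coord n → Coord n) : Prop :=
  ∀ x ∈ U, ∀ k : Fin n,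
    ∑ i, ξ x i * partialD i (fun y => ξ y k) x
      + ∑ i, ∑ j, christoffel g k i j x * ξ x i * ξ x j = 0

/-- `(U, g, ξ)` is Riemannian subprojective: a Riemannian manifold of quasi-constant sectional
curvatures whose structural unit vector field `ξ` is geodesic. -/
structure IsSubprojectiveOn {n : ℕ} (U : Set (Coord n))
    (g : Coord n → Matrix (Fin n) (Fin n) ℝ) (ξ : Coord n → Coord n) : Prop where
  riemannian : IsRiemannianWithUnitField U g ξ
  quasiConstant : IsQuasiConstantCurvature U g ξ
  geodesic : IsGeodesicField U g ξ

/-! ### Hypersurfaces in Minkowski space -/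

/-- The underlying vector space of the Minkowski space `ℝ₁ⁿ⁺¹`; only its topology and its linear
structure are used, the scalar product is `mink`. -/
abbrev Minkowski (n : ℕ) := EuclideanSpace ℝ (Fin (n + 1))

/-- The Minkowski scalar product, of signature `(n, 1)`. -/
def mink {n : ℕ} (x y : Minkowski n) : ℝ := (∑ i : Fin n, x i.succ * y i.succ) - x 0 * y 0

/-- The matrix of components of the metric induced by a parametrization `Z`. -/
def inducedMetric {n : ℕ} (Z : Coord n → Minkowski n) (x : Coord n) :
    Matrix (Fin n) (Fin n) ℝ :=
  Matrix.of fun i j => mink (fderiv ℝ Z x (basisVec i)) (fderiv ℝ Z x (basisVec j))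

section Hypersurface

variable {n : ℕ} {M : Type*} [TopologicalSpace M] [ChartedSpace (Coord n) M]

/-- The immersion `f` of the `n`-manifold `M` is a space-like hypersurface: the metric induced on
`M` is positive definite (so `f` is indeed an immersion). For a smooth chart `φ` of `M`, the map
`f ∘ φ.symm` is the corresponding local parametrization. -/
structure IsSpacelikeHypersurface (f : M → Minkowski n) : Prop where
  smooth : ContMDiff (𝓡 n) 𝓘(ℝ, Minkowski n) ∞ f
  spacelike : ∀ φ ∈ IsManifold.maximalAtlas (𝓡 n) ∞ M, ∀ x ∈ φ.target, ∀ v : Coord n, v ≠ 0 →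
    0 < mink (fderiv ℝ (f ∘ φ.symm) x v) (fderiv ℝ (f ∘ φ.symm) x v)

/-- `f : M → ℝ₁ⁿ⁺¹` is a canal space-like hypersurface with parameter function `s : M → J`,
centers `z` and radii `R`. The spherical generator with parameter `σ ∈ J` is the level set
`{p | s p = σ}`, which is `(n - 1)`-dimensional since `ds ≠ 0`. It lies on a sphere of codimension
two, the cross-section of the space-like hypersphere `(Z - z(σ))² = -R(σ)²` with a hyperplane
`⟨w, Z⟩ = c`, and the normals to the hypersurface at its points pass through `z(σ)`. -/
structure IsCanalHypersurface (f : M → Minkowski n) (s : M → ℝ) (J : Set ℝ)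
    (z : ℝ → Minkowski n) (R : ℝ → ℝ) : Prop where
  isOpen_J : IsOpen J
  interval_J : J.OrdConnected
  spacelikeHypersurface : IsSpacelikeHypersurface f
  smooth_s : ContMDiff (𝓡 n) 𝓘(ℝ, ℝ) ∞ s
  range_s : Set.range s = J
  regular_s : ∀ φ ∈ IsManifold.maximalAtlas (𝓡 n) ∞ M, ∀ x ∈ φ.target,
    fderiv ℝ (s ∘ φ.symm) x ≠ 0
  smooth_z : ContDiffOn ℝ ∞ z J
  smooth_R : ContDiffOn ℝ ∞ R J
  R_pos : ∀ σ ∈ J, 0 < R σ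
  hypersphere : ∀ p : M, mink (f p - z (s p)) (f p - z (s p)) = -(R (s p)) ^ 2
  hyperplane : ∀ σ ∈ J, ∃ w : Minkowski n, w ≠ 0 ∧ ∃ c : ℝ, ∀ p : M, s p = σ → mink w (f p) = c
  normal : ∀ φ ∈ IsManifold.maximalAtlas (𝓡 n) ∞ M, ∀ x ∈ φ.target, ∀ v : Coord n,
    mink (f (φ.symm x) - z (s (φ.symm x))) (fderiv ℝ (f ∘ φ.symm) x v) = 0

/-- Elliptic type: the curve of centers is time-like. -/
def IsEllipticType (J : Set ℝ) (z : ℝ → Minkowski n) : Prop :=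
  ∀ σ ∈ J, mink (deriv z σ) (deriv z σ) < 0

/-- Rotational: the curve of centers lies on a straight line. -/
def IsRotational (J : Set ℝ) (z : ℝ → Minkowski n) : Prop :=
  ∃ c v : Minkowski n, v ≠ 0 ∧ ∀ σ ∈ J, ∃ r : ℝ, z σ = c + r • v

/-- The unit normal `N = -(Z - z) / R`. -/
def unitNormal (f : M → Minkowski n) (s : M → ℝ) (z : ℝ → Minkowski n) (R : ℝ → ℝ)
    (p : M) : Minkowski n :=
  -((R (s p))⁻¹ • (f p - z (s p)))

/-- The vector `t - R' N` with `t = z'`. -/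
def tangentPart (f : M → Minkowski n) (s : M → ℝ) (z : ℝ → Minkowski n) (R : ℝ → ℝ)
    (p : M) : Minkowski n :=
  deriv z (s p) - deriv R (s p) • unitNormal f s z R p

/-- The structural unit tangent vector field `ξ = (t - R' N) / √((t - R' N)²)` of a canal
space-like hypersurface, as a field of vectors of the Minkowski space along `M`. -/
def structuralField (f : M → Minkowski n) (s : M → ℝ) (z : ℝ → Minkowski n) (R : ℝ → ℝ)
    (p : M) : Minkowski n :=
  (Real.sqrt (mink (tangentPart f s z R p) (tangentPart f s z R p)))⁻¹ • tangentPart f s z R p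

/-- The canal hypersurface `M`, with its induced metric and its structural vector field, is a
Riemannian subprojective manifold. In a chart, the structural field is represented by the vector
field `ξ` which the differential of the parametrization maps to `structuralField`; it is
unique because that differential is injective. -/
def IsSubprojective (f : M → Minkowski n) (s : M → ℝ) (z : ℝ → Minkowski n)
    (R : ℝ → ℝ) : Prop :=
  ∀ φ ∈ IsManifold.maximalAtlas (𝓡 n) ∞ M, ∃ ξ : Coord n → Coord n,
    (∀ x ∈ φ.target,
      fderiv ℝ (f ∘ φ.symm) x (ξ x) = structuralField f s z R (φ.symm x)) ∧
    IsSubprojectiveOn φ.target (inducedMetric (f ∘ φ.symm)) ξ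

end Hypersurface

end CanalMinkowski

end

/-! Write `F = z∘S - R N` in a chart and put `T = t - R' N`. Differentiating this equation gives `dN
= R⁻¹ (dS · T - dF)`. Differentiating `⟨N, N⟩ = -1` then yields `⟨N, t⟩ = -R'`, and differentiating
that yields `⟨dF(v), t⟩ = a dS(v)` with a function `a`, the `stretch`. So `T` is tangent to the
hypersurface and orthogonal to the generators, and `T² = t² + R'²` depends on the parameter only. It
is positive, since otherwise a generator would shrink to a point (`speedSq_pos`).

The formula for `dN` shows that the second fundamental form is `R⁻¹ (g - a dS ⊗ dS)`, with `dS`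
proportional to `g(ξ, ·)`. By the Gauss equation the sectional curvature is an affine function of
the squared cosine of the angle with `ξ`, so quasi-constant curvature is automatic
(`isQuasiConstantCurvature`). Only the geodesic condition matters. The generator component of `∇_ξ
ξ` is a nonzero multiple of that of `z''`, and its `ξ` component vanishes because `ξ` is a unit
field. Hence `ξ` is geodesic exactly when `z''` is orthogonal to all generators
(`isGeodesicField_iff_generator`).

If `z` lies on a line, `z''` is a multiple of `z'`, which is orthogonal to the generators.
Conversely, let `w` be the part of `z''` orthogonal to `z'`. If `w ≠ 0` were orthogonal to the
generators, `N` would lie in the plane of `w` and `t`, both constant along a generator. Since `dN`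
along a generator is orthogonal to both, it would vanish, and `dF` with it
(`centerCurvature_eq_zero`). So `w = 0`, the direction of `z'` is constant, and `z` runs on a line.
-/

namespace CanalMinkowski

/-! ### The Minkowski scalar product -/

section Mink

variable {n : ℕ}

/-- The Minkowski scalar product as a continuous bilinear form. -/
noncomputable def minkL (n : ℕ) : Minkowski n →L[ℝ] Minkowski n →L[ℝ] ℝ :=
  (∑ i : Fin n, (EuclideanSpace.proj (𝕜 := ℝ) (i.succ : Fin (n + 1))).smulRight
    (EuclideanSpace.proj (𝕜 := ℝ) (i.succ : Fin (n + 1)))) -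
  (EuclideanSpace.proj (𝕜 := ℝ) (0 : Fin (n + 1))).smulRight
    (EuclideanSpace.proj (𝕜 := ℝ) (0 : Fin (n + 1)))

theorem minkL_apply (x y : Minkowski n) : minkL n x y = mink x y := by
  simp [minkL, mink]

theorem mink_comm (x y : Minkowski n) : mink x y = mink y x := by
  simp only [mink, mul_comm]

@[simp] theorem mink_add_left (x y w : Minkowski n) : mink (x + y) w = mink x w + mink y w := by
  simp [← minkL_apply]

@[simp] theorem mink_add_right (x y w : Minkowski n) : mink w (x + y) = mink w x + mink w y := by
  simp [← minkL_apply]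

@[simp] theorem mink_sub_left (x y w : Minkowski n) : mink (x - y) w = mink x w - mink y w := by
  simp [← minkL_apply]

@[simp] theorem mink_sub_right (x y w : Minkowski n) : mink w (x - y) = mink w x - mink w y := by
  simp [← minkL_apply]

@[simp] theorem mink_neg_left (x w : Minkowski n) : mink (-x) w = -mink x w := by
  simp [← minkL_apply]

@[simp] theorem mink_neg_right (x w : Minkowski n) : mink w (-x) = -mink w x := by
  simp [← minkL_apply]

@[simp] theorem mink_smul_left (c : ℝ) (x w : Minkowski n) : mink (c • x) w = c * mink x w := by
  simp [← minkL_apply]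

@[simp] theorem mink_smul_right (c : ℝ) (x w : Minkowski n) : mink w (c • x) = c * mink w x := by
  simp [← minkL_apply]

@[simp] theorem mink_zero_left (w : Minkowski n) : mink 0 w = 0 := by
  simp [← minkL_apply]

@[simp] theorem mink_zero_right (w : Minkowski n) : mink w 0 = 0 := by
  simp [← minkL_apply]

theorem mink_sum_left {ι : Type*} (s : Finset ι) (x : ι → Minkowski n) (w : Minkowski n) :
    mink (∑ i ∈ s, x i) w = ∑ i ∈ s, mink (x i) w := by
  simp [← minkL_apply]

theorem mink_sum_right {ι : Type*} (s : Finset ι) (x : ι → Minkowski n) (w : Minkowski n) :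
    mink w (∑ i ∈ s, x i) = ∑ i ∈ s, mink w (x i) := by
  simp [← minkL_apply]

/-- A nonzero vector orthogonal to a time-like vector is space-like. -/
theorem mink_self_pos_of_orthogonal {t w : Minkowski n} (ht : mink t t < 0)
    (hwt : mink w t = 0) (hw : w ≠ 0) : 0 < mink w w := by
  -- Cauchy–Schwarz for the spatial parts; orthogonality turns its left side into `(w₀ t₀)²`, while
  -- `t` has spatial square below `t₀²`.
  have hcs := Finset.sum_mul_sq_le_sq_mul_sq Finset.univ (fun i : Fin n => w i.succ)
    (fun i : Fin n => t i.succ)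
  have hA : ∑ i : Fin n, w i.succ * w i.succ = ∑ i : Fin n, w i.succ ^ 2 := by
    simp only [sq]
  have hB : ∑ i : Fin n, t i.succ * t i.succ = ∑ i : Fin n, t i.succ ^ 2 := by
    simp only [sq]
  simp only [mink, hA, hB] at *
  have hA0 : 0 ≤ ∑ i : Fin n, w i.succ ^ 2 := Finset.sum_nonneg fun i _ => sq_nonneg _
  have hB0 : 0 ≤ ∑ i : Fin n, t i.succ ^ 2 := Finset.sum_nonneg fun i _ => sq_nonneg _
  have hC : ∑ i : Fin n, w i.succ * t i.succ = w 0 * t 0 := by linarith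
  rw [hC] at hcs
  by_cases h0 : ∑ i : Fin n, w i.succ ^ 2 = 0
  · exfalso
    apply hw
    have ht0 : t 0 * t 0 ≠ 0 := by nlinarith
    have hw0 : w 0 = 0 := by
      rw [h0, zero_mul] at hcs
      have : w 0 * t 0 = 0 := by nlinarith [sq_nonneg (w 0 * t 0)]
      rcases mul_eq_zero.1 this with h | h
      · exact h
      · simp [h] at ht0
    rw [Finset.sum_eq_zero_iff_of_nonneg fun i _ => sq_nonneg _] at h0
    ext i
    refine Fin.cases ?_ (fun j => ?_) i
    · simpa using hw0
    · simpa using h0 j (Finset.mem_univ j)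
  · have hApos : 0 < ∑ i : Fin n, w i.succ ^ 2 := lt_of_le_of_ne hA0 (Ne.symm h0)
    have ht2 : 0 < t 0 * t 0 := by linarith
    by_contra hcon
    have h1 : ∑ i : Fin n, w i.succ ^ 2 ≤ w 0 * w 0 := by linarith
    nlinarith [mul_le_mul_of_nonneg_right h1 ht2.le]

theorem hasFDerivAt_mink {E : Type*} [NormedAddCommGroup E] [NormedSpace ℝ E]
    {A B : E → Minkowski n} {A' B' : E →L[ℝ] Minkowski n} {x : E}
    (hA : HasFDerivAt A A' x) (hB : HasFDerivAt B B' x) :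
    HasFDerivAt (fun y => mink (A y) (B y))
      ((minkL n).precompR E (A x) B' + (minkL n).precompL E A' (B x)) x := by
  simpa only [minkL_apply] using (minkL n).hasFDerivAt_of_bilinear hA hB

theorem fderiv_mink_apply {E : Type*} [NormedAddCommGroup E] [NormedSpace ℝ E]
    {A B : E → Minkowski n} {x : E} (hA : DifferentiableAt ℝ A x) (hB : DifferentiableAt ℝ B x)
    (v : E) :
    fderiv ℝ (fun y => mink (A y) (B y)) x v =
      mink (fderiv ℝ A x v) (B x) + mink (A x) (fderiv ℝ B x v) := by
  rw [(hasFDerivAt_mink hA.hasFDerivAt hB.hasFDerivAt).fderiv]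
  simp [minkL_apply, add_comm]

theorem hasDerivAt_mink {A B : ℝ → Minkowski n} {A' B' : Minkowski n} {x : ℝ}
    (hA : HasDerivAt A A' x) (hB : HasDerivAt B B' x) :
    HasDerivAt (fun y => mink (A y) (B y)) (mink A' (B x) + mink (A x) B') x := by
  have := (minkL n).hasDerivAt_of_bilinear (fun _ => hA) (fun _ => hB)
  simpa only [minkL_apply, add_comm] using this

theorem contDiffOn_mink {E : Type*} [NormedAddCommGroup E] [NormedSpace ℝ E]
    {A B : E → Minkowski n} {U : Set E} {k : WithTop ℕ∞} (hA : ContDiffOn ℝ k A U)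
    (hB : ContDiffOn ℝ k B U) : ContDiffOn ℝ k (fun y => mink (A y) (B y)) U := by
  have := (((minkL n).contDiff (n := k)).comp_contDiffOn hA).clm_apply hB
  simpa only [minkL_apply, Function.comp] using this

end Mink

/-! ### Coordinates -/

section Coordinates

variable {n : ℕ}

theorem sum_smul_basisVec (v : Coord n) : ∑ i, v i • basisVec i = v := by
  have := (EuclideanSpace.basisFun (Fin n) ℝ).sum_repr v
  simpa [basisVec] using this

theorem map_eq_sum_basisVec {E : Type*} [NormedAddCommGroup E] [NormedSpace ℝ E]
    (L : Coord n →L[ℝ] E) (v : Coord n) : L v = ∑ i, v i • L (basisVec i) := by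
  conv_lhs => rw [← sum_smul_basisVec v]
  simp

theorem contDiffOn_det {E ι : Type*} [NormedAddCommGroup E] [NormedSpace ℝ E] [Fintype ι]
    [DecidableEq ι] {g : E → Matrix ι ι ℝ} {U : Set E} {k : WithTop ℕ∞}
    (hg : ∀ i j, ContDiffOn ℝ k (fun x => g x i j) U) :
    ContDiffOn ℝ k (fun x => (g x).det) U := by
  simp only [Matrix.det_apply']
  exact ContDiffOn.sum fun σ _ => contDiffOn_const.mul (contDiffOn_prod fun i _ => hg _ _)

/-- Cramer's rule: each entry is a cofactor, again a determinant of smooth entries, divided by the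
determinant. -/
theorem contDiffOn_matrix_inv {E ι : Type*} [NormedAddCommGroup E] [NormedSpace ℝ E] [Fintype ι]
    [DecidableEq ι] {g : E → Matrix ι ι ℝ} {U : Set E} {k : WithTop ℕ∞}
    (hg : ∀ i j, ContDiffOn ℝ k (fun x => g x i j) U) (hdet : ∀ x ∈ U, (g x).det ≠ 0) (i j : ι) :
    ContDiffOn ℝ k (fun x => (g x)⁻¹ i j) U := by
  simp only [Matrix.inv_def, Matrix.smul_apply, Ring.inverse_eq_inv', smul_eq_mul,
    Matrix.adjugate_apply]
  refine ((contDiffOn_det hg).inv hdet).mul (contDiffOn_det fun a b => ?_)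
  by_cases h : a = j
  · subst h
    simpa using contDiffOn_const
  · simpa [Matrix.updateRow_ne h] using hg a b

theorem contDiffOn_partialD {h : Coord n → ℝ} {U : Set (Coord n)} (hU : IsOpen U)
    (hh : ContDiffOn ℝ ∞ h U) (i : Fin n) : ContDiffOn ℝ ∞ (partialD i h) U :=
  (hh.fderiv_of_isOpen hU (by simp)).clm_apply contDiffOn_const

theorem metricAt_inducedMetric (F : Coord n → Minkowski n) (x X Y : Coord n) :
    metricAt (inducedMetric F) x X Y = mink (fderiv ℝ F x X) (fderiv ℝ F x Y) := by
  rw [map_eq_sum_basisVec _ X, map_eq_sum_basisVec _ Y, mink_sum_left]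
  simp only [mink_sum_right, mink_smul_left, mink_smul_right, metricAt, inducedMetric,
    Matrix.of_apply]
  refine Finset.sum_congr rfl fun i _ => Finset.sum_congr rfl fun j _ => by ring

/-- `F` is a smooth space-like parametrization defined on the open set `U`. -/
structure IsSpacelikePatch (U : Set (Coord n)) (F : Coord n → Minkowski n) : Prop where
  isOpen : IsOpen U
  smooth : ContDiffOn ℝ ∞ F U
  spacelike : ∀ x ∈ U, ∀ v : Coord n, v ≠ 0 → 0 < mink (fderiv ℝ F x v) (fderiv ℝ F x v)

/-- The second partial derivative `∂ᵢ∂ⱼF`. -/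
noncomputable def secondPartial (F : Coord n → Minkowski n) (i j : Fin n) (x : Coord n) :
    Minkowski n :=
  fderiv ℝ (fun y => fderiv ℝ F y (basisVec j)) x (basisVec i)

namespace IsSpacelikePatch

variable {U : Set (Coord n)} {F : Coord n → Minkowski n} (h : IsSpacelikePatch U F)
include h

theorem smooth_fderiv : ContDiffOn ℝ ∞ (fderiv ℝ F) U :=
  h.smooth.fderiv_of_isOpen h.isOpen (by simp)

theorem smooth_fderiv_apply (v : Coord n) : ContDiffOn ℝ ∞ (fun y => fderiv ℝ F y v) U :=
  h.smooth_fderiv.clm_apply contDiffOn_const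

theorem smooth_secondPartial (i j : Fin n) : ContDiffOn ℝ ∞ (secondPartial F i j) U :=
  ((h.smooth_fderiv_apply _).fderiv_of_isOpen h.isOpen (by simp)).clm_apply contDiffOn_const

theorem differentiableAt {E : Type*} [NormedAddCommGroup E] [NormedSpace ℝ E] {G : Coord n → E}
    (hG : ContDiffOn ℝ ∞ G U) {x : Coord n} (hx : x ∈ U) : DifferentiableAt ℝ G x :=
  (hG.contDiffAt (h.isOpen.mem_nhds hx)).differentiableAt (by simp)

theorem fderiv_fderiv_apply {x : Coord n} (hx : x ∈ U) (u v : Coord n) :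
    fderiv ℝ (fun y => fderiv ℝ F y v) x u = fderiv ℝ (fderiv ℝ F) x u v := by
  rw [fderiv_clm_apply (h.differentiableAt h.smooth_fderiv hx) (differentiableAt_const _)]
  simp

theorem fderiv_fderiv_comm {E : Type*} [NormedAddCommGroup E] [NormedSpace ℝ E] {G : Coord n → E}
    (hG : ContDiffOn ℝ ∞ G U) {x : Coord n} (hx : x ∈ U) (u v : Coord n) :
    fderiv ℝ (fun y => fderiv ℝ G y v) x u = fderiv ℝ (fun y => fderiv ℝ G y u) x v := by
  have hd := h.differentiableAt (hG.fderiv_of_isOpen h.isOpen (m := ∞) (by simp)) hx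
  rw [fderiv_clm_apply hd (differentiableAt_const _), fderiv_clm_apply hd (differentiableAt_const _)]
  simpa using (hG.contDiffAt (h.isOpen.mem_nhds hx)).isSymmSndFDerivAt
    (by simpa using WithTop.coe_le_coe.2 (le_top : (2 : ℕ∞) ≤ ⊤)) u v

theorem secondPartial_comm {x : Coord n} (hx : x ∈ U) (i j : Fin n) :
    secondPartial F i j x = secondPartial F j i x :=
  h.fderiv_fderiv_comm h.smooth hx _ _

theorem injective_fderiv {x : Coord n} (hx : x ∈ U) : Function.Injective (fderiv ℝ F x) := by
  rw [injective_iff_map_eq_zero]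
  intro v hv
  by_contra hne
  simpa [hv] using h.spacelike x hx v hne

theorem posDef_inducedMetric {x : Coord n} (hx : x ∈ U) : (inducedMetric F x).PosDef := by
  refine Matrix.PosDef.of_dotProduct_mulVec_pos ?_ fun v hv => ?_
  · ext i j
    simp [inducedMetric, mink_comm]
  · have := h.spacelike x hx (WithLp.toLp 2 v) (by simpa using hv)
    rw [← metricAt_inducedMetric] at this
    refine this.trans_eq ?_
    simp only [metricAt, dotProduct, Matrix.mulVec, star_trivial, Finset.mul_sum]
    refine Finset.sum_congr rfl fun i _ => Finset.sum_congr rfl fun j _ => by ring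

theorem det_inducedMetric_ne_zero {x : Coord n} (hx : x ∈ U) : (inducedMetric F x).det ≠ 0 :=
  (h.posDef_inducedMetric hx).det_pos.ne'

theorem smooth_inducedMetric (i j : Fin n) : ContDiffOn ℝ ∞ (fun x => inducedMetric F x i j) U :=
  contDiffOn_mink (h.smooth_fderiv_apply _) (h.smooth_fderiv_apply _)

theorem smooth_inv_inducedMetric (i j : Fin n) :
    ContDiffOn ℝ ∞ (fun x => (inducedMetric F x)⁻¹ i j) U :=
  contDiffOn_matrix_inv h.smooth_inducedMetric (fun _ hx => h.det_inducedMetric_ne_zero hx) i j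

theorem partialD_inducedMetric {x : Coord n} (hx : x ∈ U) (i j l : Fin n) :
    partialD i (fun y => inducedMetric F y j l) x =
      mink (secondPartial F i j x) (fderiv ℝ F x (basisVec l)) +
        mink (fderiv ℝ F x (basisVec j)) (secondPartial F i l x) :=
  fderiv_mink_apply (h.differentiableAt (h.smooth_fderiv_apply _) hx)
    (h.differentiableAt (h.smooth_fderiv_apply _) hx) _

/-- In the Koszul combination of the derivatives of `⟨∂F, ∂F⟩`, symmetry of second derivatives
cancels everything except `2⟨∂ᵢ∂ⱼF, ∂ₗF⟩`. -/
theorem christoffel_eq {x : Coord n} (hx : x ∈ U) (k i j : Fin n) :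
    christoffel (inducedMetric F) k i j x =
      ∑ l, (inducedMetric F x)⁻¹ k l *
        mink (secondPartial F i j x) (fderiv ℝ F x (basisVec l)) := by
  rw [christoffel, Finset.mul_sum]
  refine Finset.sum_congr rfl fun l _ => ?_
  rw [h.partialD_inducedMetric hx, h.partialD_inducedMetric hx, h.partialD_inducedMetric hx,
    h.secondPartial_comm hx l i, h.secondPartial_comm hx l j, h.secondPartial_comm hx j i,
    mink_comm (fderiv ℝ F x (basisVec j)), mink_comm (fderiv ℝ F x (basisVec i))]
  ring

theorem smooth_christoffel (k i j : Fin n) :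
    ContDiffOn ℝ ∞ (christoffel (inducedMetric F) k i j) U := by
  unfold christoffel
  refine contDiffOn_const.mul (ContDiffOn.sum fun l _ =>
    (h.smooth_inv_inducedMetric k l).mul ?_)
  exact ((contDiffOn_partialD h.isOpen (h.smooth_inducedMetric _ _) _).add
    (contDiffOn_partialD h.isOpen (h.smooth_inducedMetric _ _) _)).sub
    (contDiffOn_partialD h.isOpen (h.smooth_inducedMetric _ _) _)

theorem sum_metric_mul_inv {x : Coord n} (hx : x ∈ U) (c : Fin n → ℝ) (p : Fin n) :
    ∑ k, (∑ l, (inducedMetric F x)⁻¹ k l * c l) * inducedMetric F x k p = c p := by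
  have hs : ∀ k, inducedMetric F x k p = inducedMetric F x p k := fun k => by
    simp [inducedMetric, mink_comm]
  have hinv : inducedMetric F x * (inducedMetric F x)⁻¹ = 1 :=
    Matrix.mul_nonsing_inv _ (h.det_inducedMetric_ne_zero hx).isUnit
  have := congrFun (congrArg (fun A => Matrix.mulVec A c) hinv) p
  simp only [Matrix.one_mulVec, ← Matrix.mulVec_mulVec] at this
  rw [← this]
  simp only [Matrix.mulVec, dotProduct]
  exact Finset.sum_congr rfl fun k _ => by rw [hs, mul_comm]

/-- Gauss formula, tangential part. -/
theorem mink_secondPartial_tangent {x : Coord n} (hx : x ∈ U) (i j p : Fin n) :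
    mink (secondPartial F i j x) (fderiv ℝ F x (basisVec p)) =
      ∑ k, christoffel (inducedMetric F) k i j x * inducedMetric F x k p := by
  simp only [h.christoffel_eq hx]
  exact (h.sum_metric_mul_inv hx
    (fun l => mink (secondPartial F i j x) (fderiv ℝ F x (basisVec l))) p).symm

/-- Decomposition of a vector into its tangential and its normal part. -/
theorem exists_tangent_add_normal {x : Coord n} (hx : x ∈ U) {N : Minkowski n}
    (hN : mink N N = -1) (hNt : ∀ v, mink N (fderiv ℝ F x v) = 0) (y : Minkowski n) :
    ∃ v, y = fderiv ℝ F x v - mink y N • N := by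
  -- The map `(v, c) ↦ dF(v) + c N` is injective between spaces of dimension `n + 1`, hence onto.
  -- The minus sign in the decomposition comes from `⟨N, N⟩ = -1`.
  let L : (Coord n × ℝ) →ₗ[ℝ] Minkowski n :=
    (fderiv ℝ F x : Coord n →ₗ[ℝ] Minkowski n).coprod (LinearMap.toSpanSingleton ℝ _ N)
  have hL : ∀ v c, L (v, c) = fderiv ℝ F x v + c • N := fun v c => by simp [L]
  have hinj : Function.Injective L := by
    rw [injective_iff_map_eq_zero]
    rintro ⟨v, c⟩ hvc
    rw [hL] at hvc
    have h1 := congrArg (mink N) hvc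
    simp only [mink_add_right, hNt, mink_smul_right, hN, mink_zero_right] at h1
    have hc : c = 0 := by linarith
    subst hc
    have hv : v = 0 := h.injective_fderiv hx (by simpa using hvc)
    simp [hv]
  have hsurj : Function.Surjective L :=
    (LinearMap.injective_iff_surjective_of_finrank_eq_finrank (by simp)).1 hinj
  obtain ⟨⟨v, c⟩, hvc⟩ := hsurj y
  rw [hL] at hvc
  refine ⟨v, ?_⟩
  have : mink y N = -c := by
    rw [← hvc, mink_add_left, mink_comm, hNt, mink_smul_left, hN]; ring
  rw [this, ← hvc]
  simp

/-- The vector with components `gᵏˡ ⟨∂ₗF, dF(v)⟩` is `v`. -/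
theorem fderiv_inv_metric {x : Coord n} (hx : x ∈ U) (v : Coord n) :
    (WithLp.toLp 2 fun k => ∑ l, (inducedMetric F x)⁻¹ k l *
      mink (fderiv ℝ F x (basisVec l)) (fderiv ℝ F x v) : Coord n) = v := by
  have hinv : (inducedMetric F x)⁻¹ * inducedMetric F x = 1 :=
    Matrix.nonsing_inv_mul _ (h.det_inducedMetric_ne_zero hx).isUnit
  have hv : ∀ l, mink (fderiv ℝ F x (basisVec l)) (fderiv ℝ F x v) =
      (inducedMetric F x).mulVec v.ofLp l := fun l => by
    rw [map_eq_sum_basisVec _ v, mink_sum_right]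
    simp [Matrix.mulVec, dotProduct, inducedMetric, mul_comm]
  ext k
  simp only [hv]
  change ((inducedMetric F x)⁻¹.mulVec ((inducedMetric F x).mulVec v.ofLp)) k = v k
  rw [Matrix.mulVec_mulVec, hinv, Matrix.one_mulVec]

end IsSpacelikePatch

end Coordinates

/-! ### The Gauss equation and the covariant derivative of a tangent field -/

section GaussEquation

variable {n : ℕ}

theorem sum_curvature_form (X Y : Fin n → ℝ) (b : Fin n → Fin n → ℝ) :
    ∑ i, ∑ j, ∑ k, ∑ p, X i * Y j * Y k * X p * (b i k * b j p - b j k * b i p) =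
      (∑ i, ∑ j, X i * Y j * b i j) * (∑ i, ∑ j, Y i * X j * b i j) -
        (∑ i, ∑ j, X i * X j * b i j) * ∑ i, ∑ j, Y i * Y j * b i j := by
  simp only [mul_sub, Finset.sum_sub_distrib]
  congr 1
  · rw [Finset.sum_mul]
    refine Finset.sum_congr rfl fun i _ => ?_
    rw [Finset.mul_sum]
    refine Finset.sum_congr rfl fun j _ => ?_
    rw [Finset.sum_mul]
    refine Finset.sum_congr rfl fun k _ => ?_
    rw [Finset.mul_sum]
    exact Finset.sum_congr rfl fun p _ => by ring
  · rw [Finset.sum_mul]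
    refine Finset.sum_congr rfl fun i _ => ?_
    rw [mul_comm, Finset.sum_mul]
    refine Finset.sum_congr rfl fun j _ => ?_
    rw [Finset.sum_mul]
    refine Finset.sum_congr rfl fun k _ => ?_
    rw [Finset.mul_sum]
    exact Finset.sum_congr rfl fun p _ => by ring

namespace IsSpacelikePatch

variable {U : Set (Coord n)} {F : Coord n → Minkowski n} (h : IsSpacelikePatch U F)
include h

/-- The image of `u - v` is orthogonal to the whole tangent space, hence to itself, and the induced
metric is definite. -/
theorem eq_of_mink_tangent {x : Coord n} (hx : x ∈ U) {u v : Coord n}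
    (huv : ∀ p, mink (fderiv ℝ F x u) (fderiv ℝ F x (basisVec p)) =
      mink (fderiv ℝ F x v) (fderiv ℝ F x (basisVec p))) : u = v := by
  by_contra hne
  have hpos := h.spacelike x hx (u - v) (sub_ne_zero.2 hne)
  rw [map_eq_sum_basisVec (fderiv ℝ F x) (u - v)] at hpos
  rw [mink_sum_right] at hpos
  refine hpos.ne' (Finset.sum_eq_zero fun p _ => ?_)
  rw [← map_eq_sum_basisVec, map_sub, mink_smul_right, mink_sub_left, huv, sub_self, mul_zero]

/-- Gauss formula. -/
theorem secondPartial_eq {x : Coord n} (hx : x ∈ U) {N : Minkowski n}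
    (hN : mink N N = -1) (hNt : ∀ v, mink N (fderiv ℝ F x v) = 0) (i j : Fin n) :
    secondPartial F i j x =
      ∑ k, christoffel (inducedMetric F) k i j x • fderiv ℝ F x (basisVec k) -
        mink (secondPartial F i j x) N • N := by
  obtain ⟨v, hv⟩ := h.exists_tangent_add_normal hx hN hNt (secondPartial F i j x)
  have hΓ : v = WithLp.toLp 2 fun k => christoffel (inducedMetric F) k i j x := by
    refine h.eq_of_mink_tangent hx fun p => ?_
    have h1 := h.mink_secondPartial_tangent hx i j p
    rw [hv, mink_sub_left, mink_smul_left, hNt, mul_zero, sub_zero] at h1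
    rw [h1, map_eq_sum_basisVec, mink_sum_left]
    simp [inducedMetric]
  have hs : fderiv ℝ F x v =
      ∑ k, christoffel (inducedMetric F) k i j x • fderiv ℝ F x (basisVec k) := by
    rw [map_eq_sum_basisVec, hΓ]
  rw [← hs]
  exact hv

/-- Obtained by differentiating the tangential Gauss formula along `∂ᵢ`. The product of normal
components enters with a plus sign because `N` is time-like. The left side is symmetric in `i` and
`j`, so exchanging them and subtracting produces the Gauss equation. -/
theorem mink_thirdPartial_tangent {x : Coord n} (hx : x ∈ U) {N : Minkowski n}
    (hN : mink N N = -1) (hNt : ∀ v, mink N (fderiv ℝ F x v) = 0) (i j k p : Fin n) :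
    mink (fderiv ℝ (secondPartial F j k) x (basisVec i)) (fderiv ℝ F x (basisVec p)) =
      ∑ l, inducedMetric F x l p * partialD i (christoffel (inducedMetric F) l j k) x +
        ∑ l, inducedMetric F x l p * ∑ m, christoffel (inducedMetric F) m j k x *
          christoffel (inducedMetric F) l i m x +
        mink (secondPartial F j k x) N * mink (secondPartial F i p x) N := by
  have hev : (fun y => mink (secondPartial F j k y) (fderiv ℝ F y (basisVec p))) =ᶠ[nhds x]
      fun y => ∑ l, christoffel (inducedMetric F) l j k y * inducedMetric F y l p := by
    filter_upwards [h.isOpen.mem_nhds hx] with y hy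
    exact h.mink_secondPartial_tangent hy j k p
  have hd := congrArg (fun L : Coord n →L[ℝ] ℝ => L (basisVec i)) hev.fderiv_eq
  have hΓ : ∀ l, DifferentiableAt ℝ (christoffel (inducedMetric F) l j k) x :=
    fun l => h.differentiableAt (h.smooth_christoffel _ _ _) hx
  have hg : ∀ l, DifferentiableAt ℝ (fun y => inducedMetric F y l p) x :=
    fun l => h.differentiableAt (h.smooth_inducedMetric _ _) hx
  rw [fderiv_mink_apply (h.differentiableAt (h.smooth_secondPartial _ _) hx)
    (h.differentiableAt (h.smooth_fderiv_apply _) hx),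
    fderiv_fun_sum fun l _ => (hΓ l).fun_mul (hg l), sum_apply] at hd
  have hterm : ∀ l, fderiv ℝ (fun y => christoffel (inducedMetric F) l j k y *
      inducedMetric F y l p) x (basisVec i) =
      inducedMetric F x l p * partialD i (christoffel (inducedMetric F) l j k) x +
      christoffel (inducedMetric F) l j k x *
        (∑ m, christoffel (inducedMetric F) m i l x * inducedMetric F x m p) +
      christoffel (inducedMetric F) l j k x *
        mink (fderiv ℝ F x (basisVec l)) (secondPartial F i p x) := by
    intro l
    rw [fderiv_fun_mul (hΓ l) (hg l)]
    have h1 := h.partialD_inducedMetric hx i l p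
    rw [h.mink_secondPartial_tangent hx] at h1
    rw [partialD] at h1
    simp only [add_apply, smul_apply, smul_eq_mul, h1, partialD]
    ring
  simp only [hterm, Finset.sum_add_distrib] at hd
  have h2 : mink (secondPartial F j k x) (secondPartial F i p x) =
      ∑ l, christoffel (inducedMetric F) l j k x *
        mink (fderiv ℝ F x (basisVec l)) (secondPartial F i p x) -
      mink (secondPartial F j k x) N * mink (secondPartial F i p x) N := by
    conv_lhs => rw [h.secondPartial_eq hx hN hNt j k]
    rw [mink_sub_left, mink_sum_left, mink_smul_left, mink_comm N]
    simp only [mink_smul_left]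
  have h3 : ∑ l, christoffel (inducedMetric F) l j k x *
        (∑ m, christoffel (inducedMetric F) m i l x * inducedMetric F x m p) =
      ∑ l, inducedMetric F x l p * ∑ m, christoffel (inducedMetric F) m j k x *
          christoffel (inducedMetric F) l i m x := by
    simp only [Finset.mul_sum]
    rw [Finset.sum_comm]
    exact Finset.sum_congr rfl fun _ _ => Finset.sum_congr rfl fun _ _ => by ring
  have h4 : fderiv ℝ (fun y => fderiv ℝ F y (basisVec p)) x (basisVec i) =
      secondPartial F i p x := rfl
  rw [h4, h2, h3] at hd
  linarith

/-- Gauss equation, in components. -/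
theorem gauss_equation_comp {x : Coord n} (hx : x ∈ U) {N : Minkowski n}
    (hN : mink N N = -1) (hNt : ∀ v, mink N (fderiv ℝ F x v) = 0) (i j k p : Fin n) :
    ∑ l, inducedMetric F x l p * curvatureComp (inducedMetric F) l i j k x =
      mink (secondPartial F i k x) N * mink (secondPartial F j p x) N -
        mink (secondPartial F j k x) N * mink (secondPartial F i p x) N := by
  have h1 := h.mink_thirdPartial_tangent hx hN hNt i j k p
  have h2 := h.mink_thirdPartial_tangent hx hN hNt j i k p
  have h3 : fderiv ℝ (secondPartial F j k) x (basisVec i) =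
      fderiv ℝ (secondPartial F i k) x (basisVec j) :=
    h.fderiv_fderiv_comm (h.smooth_fderiv_apply (basisVec k)) hx _ _
  rw [h3] at h1
  have h4 : ∑ l, inducedMetric F x l p * curvatureComp (inducedMetric F) l i j k x =
      ∑ l, inducedMetric F x l p * partialD i (christoffel (inducedMetric F) l j k) x -
      ∑ l, inducedMetric F x l p * partialD j (christoffel (inducedMetric F) l i k) x +
      (∑ l, inducedMetric F x l p * ∑ m, christoffel (inducedMetric F) m j k x *
          christoffel (inducedMetric F) l i m x -
        ∑ l, inducedMetric F x l p * ∑ m, christoffel (inducedMetric F) m i k x *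
          christoffel (inducedMetric F) l j m x) := by
    simp only [← Finset.sum_sub_distrib, ← Finset.sum_add_distrib, curvatureComp]
    refine Finset.sum_congr rfl fun l _ => ?_
    rw [Finset.sum_sub_distrib]
    ring
  linarith

/-- The scalar product of the second derivative with a fixed vector, as a bilinear form. -/
theorem mink_fderiv_fderiv {x : Coord n} (hx : x ∈ U) (N : Minkowski n) (X Y : Coord n) :
    mink (fderiv ℝ (fun y => fderiv ℝ F y Y) x X) N =
      ∑ i, ∑ j, X i * Y j * mink (secondPartial F i j x) N := by
  rw [h.fderiv_fderiv_apply hx, map_eq_sum_basisVec _ X, sum_apply, mink_sum_left]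
  refine Finset.sum_congr rfl fun i _ => ?_
  rw [smul_apply, map_eq_sum_basisVec _ Y, mink_smul_left, mink_sum_left, Finset.mul_sum]
  refine Finset.sum_congr rfl fun j _ => ?_
  rw [mink_smul_left, secondPartial, h.fderiv_fderiv_apply hx]
  ring

/-- Gauss equation for the sectional curvature. -/
theorem gauss_equation {x : Coord n} (hx : x ∈ U) {N : Minkowski n}
    (hN : mink N N = -1) (hNt : ∀ v, mink N (fderiv ℝ F x v) = 0) (X Y : Coord n) :
    curvature (inducedMetric F) x X Y Y X =
      mink (fderiv ℝ (fun y => fderiv ℝ F y Y) x X) N ^ 2 -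
        mink (fderiv ℝ (fun y => fderiv ℝ F y X) x X) N *
          mink (fderiv ℝ (fun y => fderiv ℝ F y Y) x Y) N := by
  have hcurv : curvature (inducedMetric F) x X Y Y X = ∑ i, ∑ j, ∑ k, ∑ p,
      X i * Y j * Y k * X p * (mink (secondPartial F i k x) N * mink (secondPartial F j p x) N -
        mink (secondPartial F j k x) N * mink (secondPartial F i p x) N) := by
    unfold curvature
    refine Finset.sum_congr rfl fun i _ => Finset.sum_congr rfl fun j _ =>
      Finset.sum_congr rfl fun k _ => ?_
    rw [Finset.sum_comm]
    refine Finset.sum_congr rfl fun p _ => ?_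
    rw [← h.gauss_equation_comp hx hN hNt, Finset.mul_sum]
    exact Finset.sum_congr rfl fun l _ => by ring
  have hsym : mink (fderiv ℝ (fun y => fderiv ℝ F y Y) x X) N =
      mink (fderiv ℝ (fun y => fderiv ℝ F y X) x Y) N := by
    rw [h.fderiv_fderiv_comm h.smooth hx]
  rw [sq]
  nth_rewrite 2 [hsym]
  rw [h.mink_fderiv_fderiv hx N X Y, h.mink_fderiv_fderiv hx N Y X,
    h.mink_fderiv_fderiv hx N X X, h.mink_fderiv_fderiv hx N Y Y, hcurv]
  exact sum_curvature_form X.ofLp Y.ofLp fun i j => mink (secondPartial F i j x) N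

/-- The tangential part of the derivative of `dF(ξ)` along `ξ` is `dF(∇_ξ ξ)`. -/
theorem mink_fderiv_field {ξ : Coord n → Coord n} (hξ : ContDiffOn ℝ ∞ ξ U) {x : Coord n}
    (hx : x ∈ U) (p : Fin n) :
    mink (fderiv ℝ (fun y => fderiv ℝ F y (ξ y)) x (ξ x)) (fderiv ℝ F x (basisVec p)) =
      ∑ k, (∑ i, ξ x i * partialD i (fun y => ξ y k) x +
        ∑ i, ∑ j, christoffel (inducedMetric F) k i j x * ξ x i * ξ x j) *
          inducedMetric F x k p := by
  have hξd := h.differentiableAt hξ hx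
  rw [fderiv_clm_apply (h.differentiableAt h.smooth_fderiv hx) hξd]
  simp only [add_apply, ContinuousLinearMap.comp_apply, ContinuousLinearMap.flip_apply,
    mink_add_left, add_mul, Finset.sum_add_distrib]
  have hcoord : ∀ k, fderiv ℝ ξ x (ξ x) k = ∑ i, ξ x i * partialD i (fun y => ξ y k) x := by
    intro k
    have hk : fderiv ℝ (fun y => ξ y k) x =
        (EuclideanSpace.proj (𝕜 := ℝ) k : Coord n →L[ℝ] ℝ).comp (fderiv ℝ ξ x) :=
      ((EuclideanSpace.proj (𝕜 := ℝ) k : Coord n →L[ℝ] ℝ).hasFDerivAt.comp x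
        hξd.hasFDerivAt).fderiv
    have := map_eq_sum_basisVec (fderiv ℝ (fun y => ξ y k) x) (ξ x)
    rw [hk] at this
    simp only [partialD, hk]
    simpa using this
  congr 1
  · rw [map_eq_sum_basisVec, mink_sum_left]
    refine Finset.sum_congr rfl fun k _ => ?_
    rw [hcoord, mink_smul_left]
    rfl
  · rw [← h.fderiv_fderiv_apply hx, h.mink_fderiv_fderiv hx]
    simp only [h.mink_secondPartial_tangent hx, Finset.sum_mul, Finset.mul_sum]
    symm
    rw [Finset.sum_comm]
    refine Finset.sum_congr rfl fun i _ => ?_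
    rw [Finset.sum_comm]
    exact Finset.sum_congr rfl fun j _ => Finset.sum_congr rfl fun k _ => by ring

/-- The tangential part of the ambient derivative of `dF(ξ)` along `ξ` is `dF(∇_ξ ξ)`. This replaces
Christoffel symbols by a condition in the ambient space. -/
theorem isGeodesicField_iff {ξ : Coord n → Coord n} (hξ : ContDiffOn ℝ ∞ ξ U) :
    IsGeodesicField U (inducedMetric F) ξ ↔ ∀ x ∈ U, ∀ v,
      mink (fderiv ℝ (fun y => fderiv ℝ F y (ξ y)) x (ξ x)) (fderiv ℝ F x v) = 0 := by
  refine forall₂_congr fun x hx => ⟨fun hg v => ?_, fun hg k => ?_⟩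
  · rw [map_eq_sum_basisVec _ v, mink_sum_right]
    refine Finset.sum_eq_zero fun p _ => ?_
    rw [mink_smul_right, h.mink_fderiv_field hξ hx]
    simp [hg]
  · have h1 : (WithLp.toLp 2 fun k => ∑ i, ξ x i * partialD i (fun y => ξ y k) x +
        ∑ i, ∑ j, christoffel (inducedMetric F) k i j x * ξ x i * ξ x j : Coord n) = 0 := by
      refine h.eq_of_mink_tangent hx fun p => ?_
      rw [map_zero, mink_zero_left, ← hg (basisVec p), h.mink_fderiv_field hξ hx,
        map_eq_sum_basisVec, mink_sum_left]
      simp only [mink_smul_left]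
      rfl
    exact congrArg (fun v : Coord n => v k) h1

end IsSpacelikePatch

end GaussEquation

/-! ### Canal patches: normal, second fundamental form and structural field -/

section CanalPatch

variable {n : ℕ}

/-- A coordinate patch `F` of a canal space-like hypersurface of elliptic type with parameter
function `S`, centers `z` and radii `R`. -/
structure IsCanalPatch (U : Set (Coord n)) (F : Coord n → Minkowski n) (S : Coord n → ℝ)
    (J : Set ℝ) (z : ℝ → Minkowski n) (R : ℝ → ℝ) : Prop extends IsSpacelikePatch U F where
  isOpen_J : IsOpen J
  mapsTo : ∀ x ∈ U, S x ∈ J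
  smooth_S : ContDiffOn ℝ ∞ S U
  regular : ∀ x ∈ U, fderiv ℝ S x ≠ 0
  smooth_z : ContDiffOn ℝ ∞ z J
  smooth_R : ContDiffOn ℝ ∞ R J
  R_pos : ∀ σ ∈ J, 0 < R σ
  hypersphere : ∀ x ∈ U, mink (F x - z (S x)) (F x - z (S x)) = -(R (S x)) ^ 2
  normal : ∀ x ∈ U, ∀ v, mink (F x - z (S x)) (fderiv ℝ F x v) = 0
  timelike : ∀ σ ∈ J, mink (deriv z σ) (deriv z σ) < 0

/-- The function `t² + R'²` of the parameter, which is the square of `t - R' N`. -/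
noncomputable def speedSq (z : ℝ → Minkowski n) (R : ℝ → ℝ) (σ : ℝ) : ℝ :=
  mink (deriv z σ) (deriv z σ) + deriv R σ ^ 2

/-- The factor `a` for which `⟨dF(v), t - R' N⟩ = a dS(v)`. -/
noncomputable def stretch (F : Coord n → Minkowski n) (S : Coord n → ℝ) (z : ℝ → Minkowski n)
    (R : ℝ → ℝ) (x : Coord n) : ℝ :=
  speedSq z R (S x) + R (S x) *
    (mink (unitNormal F S z R x) (deriv (deriv z) (S x)) + deriv (deriv R) (S x))

namespace IsCanalPatch

variable {U : Set (Coord n)} {F : Coord n → Minkowski n} {S : Coord n → ℝ}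
  {J : Set ℝ} {z : ℝ → Minkowski n} {R : ℝ → ℝ} (h : IsCanalPatch U F S J z R)
include h

theorem smooth_comp_param {E : Type*} [NormedAddCommGroup E] [NormedSpace ℝ E] {c : ℝ → E}
    (hc : ContDiffOn ℝ ∞ c J) : ContDiffOn ℝ ∞ (fun x => c (S x)) U :=
  hc.comp h.smooth_S h.mapsTo

theorem smooth_deriv_z : ContDiffOn ℝ ∞ (deriv z) J :=
  h.smooth_z.deriv_of_isOpen h.isOpen_J (by simp)

theorem smooth_deriv_R : ContDiffOn ℝ ∞ (deriv R) J :=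
  h.smooth_R.deriv_of_isOpen h.isOpen_J (by simp)

theorem hasDerivAt_param {E : Type*} [NormedAddCommGroup E] [NormedSpace ℝ E] {c : ℝ → E}
    (hc : ContDiffOn ℝ ∞ c J) {σ : ℝ} (hσ : σ ∈ J) : HasDerivAt c (deriv c σ) σ :=
  ((hc.contDiffAt (h.isOpen_J.mem_nhds hσ)).differentiableAt (by simp)).hasDerivAt

theorem fderiv_comp_param {E : Type*} [NormedAddCommGroup E] [NormedSpace ℝ E] {c : ℝ → E}
    (hc : ContDiffOn ℝ ∞ c J) {x : Coord n} (hx : x ∈ U) (v : Coord n) :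
    fderiv ℝ (fun y => c (S y)) x v = fderiv ℝ S x v • deriv c (S x) := by
  have h1 := (h.hasDerivAt_param hc (h.mapsTo x hx)).hasFDerivAt.comp x
    (h.differentiableAt h.smooth_S hx).hasFDerivAt
  have h2 : fderiv ℝ (fun y => c (S y)) x = _ := h1.fderiv
  rw [h2]
  simp

theorem smooth_unitNormal : ContDiffOn ℝ ∞ (unitNormal F S z R) U :=
  (((h.smooth_comp_param h.smooth_R).inv fun x hx => (h.R_pos _ (h.mapsTo x hx)).ne').smul
    (h.smooth.sub (h.smooth_comp_param h.smooth_z))).neg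

theorem smooth_tangentPart : ContDiffOn ℝ ∞ (tangentPart F S z R) U :=
  (h.smooth_comp_param h.smooth_deriv_z).sub
    ((h.smooth_comp_param h.smooth_deriv_R).smul h.smooth_unitNormal)

theorem param_eq {x : Coord n} (hx : x ∈ U) :
    F x = z (S x) - R (S x) • unitNormal F S z R x := by
  have hR := (h.R_pos _ (h.mapsTo x hx)).ne'
  simp [unitNormal, smul_smul, hR]

theorem mink_unitNormal_self {x : Coord n} (hx : x ∈ U) :
    mink (unitNormal F S z R x) (unitNormal F S z R x) = -1 := by
  have hR := (h.R_pos _ (h.mapsTo x hx)).ne'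
  rw [unitNormal, mink_neg_left, mink_neg_right, mink_smul_left, mink_smul_right,
    h.hypersphere x hx]
  field_simp

theorem mink_unitNormal_fderiv {x : Coord n} (hx : x ∈ U) (v : Coord n) :
    mink (unitNormal F S z R x) (fderiv ℝ F x v) = 0 := by
  rw [unitNormal, mink_neg_left, mink_smul_left, h.normal x hx]
  simp

/-- Differentiate `F = z∘S - R N` and solve for `dN`. In directions with `dS(v) = 0` this says that
`dN` is `-R⁻¹ dF`, as on a sphere. -/
theorem fderiv_unitNormal {x : Coord n} (hx : x ∈ U) (v : Coord n) :
    fderiv ℝ (unitNormal F S z R) x v =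
      (R (S x))⁻¹ • (fderiv ℝ S x v • tangentPart F S z R x - fderiv ℝ F x v) := by
  have hR := (h.R_pos _ (h.mapsTo x hx)).ne'
  have hev : F =ᶠ[nhds x] fun y => z (S y) - R (S y) • unitNormal F S z R y := by
    filter_upwards [h.isOpen.mem_nhds hx] with y hy using h.param_eq hy
  have hd := congrArg (fun L : Coord n →L[ℝ] Minkowski n => L v) hev.fderiv_eq
  have hRd := h.differentiableAt (h.smooth_comp_param h.smooth_R) hx
  have hNd := h.differentiableAt h.smooth_unitNormal hx
  rw [fderiv_fun_sub (h.differentiableAt (h.smooth_comp_param h.smooth_z) hx) (hRd.fun_smul hNd),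
    fderiv_fun_smul hRd hNd] at hd
  simp only [sub_apply, add_apply, smul_apply, ContinuousLinearMap.smulRight_apply,
    h.fderiv_comp_param h.smooth_z hx, h.fderiv_comp_param h.smooth_R hx] at hd
  rw [hd, eq_inv_smul_iff₀ hR, tangentPart, smul_eq_mul]
  module

/-- Since `N²` is constant, `0 = ⟨N, dN(v)⟩ = R⁻¹ dS(v) ⟨N, T⟩`; a direction with `dS(v) ≠ 0` gives
`⟨N, T⟩ = 0`. -/
theorem mink_unitNormal_deriv {x : Coord n} (hx : x ∈ U) :
    mink (unitNormal F S z R x) (deriv z (S x)) = -deriv R (S x) := by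
  obtain ⟨v, hv⟩ : ∃ v, fderiv ℝ S x v ≠ 0 := by
    by_contra! hcon
    exact h.regular x hx (ContinuousLinearMap.ext hcon)
  have hR := (h.R_pos _ (h.mapsTo x hx)).ne'
  have hev : (fun y => mink (unitNormal F S z R y) (unitNormal F S z R y)) =ᶠ[nhds x]
      fun _ => (-1 : ℝ) := by
    filter_upwards [h.isOpen.mem_nhds hx] with y hy using h.mink_unitNormal_self hy
  have hd := congrArg (fun L : Coord n →L[ℝ] ℝ => L v) hev.fderiv_eq
  have hNd := h.differentiableAt h.smooth_unitNormal hx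
  rw [fderiv_mink_apply hNd hNd, mink_comm, h.fderiv_unitNormal hx] at hd
  simp only [tangentPart, mink_smul_right, mink_sub_right, h.mink_unitNormal_fderiv hx,
    h.mink_unitNormal_self hx, fderiv_fun_const, Pi.zero_apply, zero_apply] at hd
  have h1 : mink (unitNormal F S z R x) (deriv z (S x)) - -deriv R (S x) = 0 := by
    field_simp at hd
    refine (mul_eq_zero.1 ?_).resolve_left hv
    linarith
  linarith

theorem mink_tangentPart_unitNormal {x : Coord n} (hx : x ∈ U) :
    mink (tangentPart F S z R x) (unitNormal F S z R x) = 0 := by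
  rw [tangentPart, mink_sub_left, mink_comm, h.mink_unitNormal_deriv hx, mink_smul_left,
    h.mink_unitNormal_self hx]
  ring

theorem mink_tangentPart_deriv {x : Coord n} (hx : x ∈ U) :
    mink (tangentPart F S z R x) (deriv z (S x)) = speedSq z R (S x) := by
  rw [tangentPart, mink_sub_left, mink_smul_left, h.mink_unitNormal_deriv hx, speedSq]
  ring

theorem mink_tangentPart_self {x : Coord n} (hx : x ∈ U) :
    mink (tangentPart F S z R x) (tangentPart F S z R x) = speedSq z R (S x) := by
  nth_rewrite 2 [tangentPart]
  rw [mink_sub_right, mink_smul_right, h.mink_tangentPart_deriv hx,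
    h.mink_tangentPart_unitNormal hx]
  ring

/-- Derivative of the identity `⟨N, t⟩ = -R'`, with the formula for `dN` inserted. In particular `t`
is orthogonal to the generators. -/
theorem mink_fderiv_deriv {x : Coord n} (hx : x ∈ U) (v : Coord n) :
    mink (fderiv ℝ F x v) (deriv z (S x)) = stretch F S z R x * fderiv ℝ S x v := by
  have hR := (h.R_pos _ (h.mapsTo x hx)).ne'
  have hev : (fun y => mink (unitNormal F S z R y) (deriv z (S y))) =ᶠ[nhds x]
      fun y => -deriv R (S y) := by
    filter_upwards [h.isOpen.mem_nhds hx] with y hy using h.mink_unitNormal_deriv hy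
  have hd := congrArg (fun L : Coord n →L[ℝ] ℝ => L v) hev.fderiv_eq
  rw [fderiv_mink_apply (h.differentiableAt h.smooth_unitNormal hx)
    (h.differentiableAt (h.smooth_comp_param h.smooth_deriv_z) hx), fderiv_fun_neg,
    h.fderiv_unitNormal hx, h.fderiv_comp_param h.smooth_deriv_z hx] at hd
  simp only [neg_apply, h.fderiv_comp_param h.smooth_deriv_R hx, mink_smul_left, mink_sub_left,
    h.mink_tangentPart_deriv hx, mink_smul_right, smul_eq_mul] at hd
  field_simp at hd
  rw [stretch]
  linarith

theorem mink_fderiv_tangentPart {x : Coord n} (hx : x ∈ U) (v : Coord n) :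
    mink (fderiv ℝ F x v) (tangentPart F S z R x) = stretch F S z R x * fderiv ℝ S x v := by
  rw [tangentPart, mink_sub_right, h.mink_fderiv_deriv hx, mink_smul_right, mink_comm _
    (unitNormal F S z R x), h.mink_unitNormal_fderiv hx]
  ring

theorem exists_fderiv_eq_tangentPart {x : Coord n} (hx : x ∈ U) :
    ∃ v, fderiv ℝ F x v = tangentPart F S z R x := by
  obtain ⟨v, hv⟩ := h.exists_tangent_add_normal hx (h.mink_unitNormal_self hx)
    (h.mink_unitNormal_fderiv hx) (tangentPart F S z R x)
  rw [h.mink_tangentPart_unitNormal hx, zero_smul, sub_zero] at hv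
  exact ⟨v, hv.symm⟩

/-- The vanishing of `t² + R'²` would force the generator to be a point. -/
theorem speedSq_pos (hn : 2 ≤ n) {x : Coord n} (hx : x ∈ U) : 0 < speedSq z R (S x) := by
  by_contra hcon
  -- `T` is tangent, hence space-like or zero, and its square is the same along the whole generator.
  have hzero : ∀ y ∈ U, S y = S x → tangentPart F S z R y = 0 := by
    intro y hy hyx
    obtain ⟨v, hv⟩ := h.exists_fderiv_eq_tangentPart hy
    by_contra hne
    have hv0 : v ≠ 0 := by
      rintro rfl
      exact hne (by rw [← hv, map_zero])
    have := h.spacelike y hy v hv0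
    rw [hv, h.mink_tangentPart_self hy, hyx] at this
    exact hcon this
  have hR' : deriv R (S x) ≠ 0 := by
    intro h0
    have h1 := hzero x hx rfl
    rw [tangentPart, h0, zero_smul, sub_zero] at h1
    have h2 := h.timelike _ (h.mapsTo x hx)
    rw [h1] at h2
    simp at h2
  -- Now `t = R' N` with `R' ≠ 0`, so `N` depends only on the parameter, and so does `F = z - R N`.
  have hconst : ∀ y ∈ U, S y = S x → F y = F x := by
    intro y hy hyx
    have h1 := hzero y hy hyx
    have h2 := hzero x hx rfl
    rw [tangentPart, hyx] at h1
    rw [tangentPart] at h2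
    have h3 : unitNormal F S z R y = unitNormal F S z R x :=
      smul_right_injective _ hR' ((sub_eq_zero.1 h1).symm.trans (sub_eq_zero.1 h2))
    rw [h.param_eq hy, h.param_eq hx, h3, hyx]
  obtain ⟨v, hv, hv0⟩ := Submodule.exists_mem_ne_zero_of_ne_bot
    (LinearMap.ker_ne_bot_of_finrank_lt (f := (fderiv ℝ S x : Coord n →ₗ[ℝ] ℝ))
      (by simp; omega))
  have hv : fderiv ℝ S x v = 0 := hv
  have hstrict : ∀ {E : Type} [NormedAddCommGroup E] [NormedSpace ℝ E] {G : Coord n → E},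
      ContDiffOn ℝ ∞ G U → HasStrictFDerivAt G (fderiv ℝ G x) x := fun hG =>
    (hG.contDiffAt (h.isOpen.mem_nhds hx)).hasStrictFDerivAt (by simp)
  have hFv : fderiv ℝ F x v = 0 := by
    ext i
    have hFi : HasStrictFDerivAt (fun y => F y i)
        ((EuclideanSpace.proj (𝕜 := ℝ) i : Minkowski n →L[ℝ] ℝ).comp (fderiv ℝ F x)) x :=
      (EuclideanSpace.proj (𝕜 := ℝ) i : Minkowski n →L[ℝ] ℝ).hasStrictFDerivAt.comp x
        (hstrict h.smooth)
    have hext : IsLocalExtrOn (fun y => F y i) {y | S y = S x} x := by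
      left
      have : ∀ᶠ y in nhdsWithin x {y | S y = S x}, y ∈ U ∧ S y = S x :=
        Filter.inter_mem (mem_nhdsWithin_of_mem_nhds (h.isOpen.mem_nhds hx)) self_mem_nhdsWithin
      filter_upwards [this] with y hy
      rw [hconst y hy.1 hy.2]
    -- Each coordinate of `F` is constant on the level set of `S`, thus trivially extremal there;
    -- the Lagrange multiplier makes its differential a multiple of `dS`, which kills `v`.
    obtain ⟨a, b, hab, h0⟩ :=
      hext.exists_multipliers_of_hasStrictFDerivAt_1d (hstrict h.smooth_S) hFi
    have hb : b ≠ 0 := by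
      rintro rfl
      have ha : a ≠ 0 := fun ha => hab (by simp [ha])
      rw [zero_smul, add_zero, smul_eq_zero] at h0
      exact h.regular x hx (h0.resolve_left ha)
    have h1 := congrArg (fun L : Coord n →L[ℝ] ℝ => L v) h0
    simpa [hv, hb] using h1
  have := h.spacelike x hx v hv0
  simp [hFv] at this

theorem structuralField_eq {x : Coord n} (hx : x ∈ U) :
    structuralField F S z R x = (Real.sqrt (speedSq z R (S x)))⁻¹ • tangentPart F S z R x := by
  rw [structuralField, h.mink_tangentPart_self hx]

theorem mink_structuralField_self (hn : 2 ≤ n) {x : Coord n} (hx : x ∈ U) :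
    mink (structuralField F S z R x) (structuralField F S z R x) = 1 := by
  have hp := h.speedSq_pos hn hx
  have hs := Real.sqrt_pos.2 hp
  rw [h.structuralField_eq hx, mink_smul_left, mink_smul_right, h.mink_tangentPart_self hx]
  field_simp
  rw [Real.sq_sqrt hp.le]

theorem mink_fderiv_structuralField {x : Coord n} (hx : x ∈ U) (v : Coord n) :
    mink (fderiv ℝ F x v) (structuralField F S z R x) =
      (Real.sqrt (speedSq z R (S x)))⁻¹ * (stretch F S z R x * fderiv ℝ S x v) := by
  rw [h.structuralField_eq hx, mink_smul_right, h.mink_fderiv_tangentPart hx]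

theorem smooth_inv_sqrt_speedSq (hn : 2 ≤ n) :
    ContDiffOn ℝ ∞ (fun x => (Real.sqrt (speedSq z R (S x)))⁻¹) U := by
  have hs : ContDiffOn ℝ ∞ (fun x => speedSq z R (S x)) U :=
    h.smooth_comp_param ((contDiffOn_mink h.smooth_deriv_z h.smooth_deriv_z).add
      (h.smooth_deriv_R.pow 2))
  exact (hs.sqrt fun x hx => (h.speedSq_pos hn hx).ne').inv
    fun x hx => (Real.sqrt_pos.2 (h.speedSq_pos hn hx)).ne'

theorem smooth_structuralField (hn : 2 ≤ n) : ContDiffOn ℝ ∞ (structuralField F S z R) U :=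
  ((h.smooth_inv_sqrt_speedSq hn).smul h.smooth_tangentPart).congr
    fun _ hx => h.structuralField_eq hx

/-- The structural field is represented in coordinates by a smooth vector field. -/
theorem exists_smooth_field (hn : 2 ≤ n) : ∃ ξ : Coord n → Coord n, ContDiffOn ℝ ∞ ξ U ∧
    ∀ x ∈ U, fderiv ℝ F x (ξ x) = structuralField F S z R x := by
  refine ⟨fun x => WithLp.toLp 2 fun k => ∑ l, (inducedMetric F x)⁻¹ k l *
      mink (fderiv ℝ F x (basisVec l)) (structuralField F S z R x), ?_, fun x hx => ?_⟩
  · rw [contDiffOn_euclidean]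
    intro k
    have hk : ContDiffOn ℝ ∞ (fun x => ∑ l, (inducedMetric F x)⁻¹ k l *
        mink (fderiv ℝ F x (basisVec l)) (structuralField F S z R x)) U :=
      ContDiffOn.sum fun l _ => (h.smooth_inv_inducedMetric k l).mul
        (contDiffOn_mink (h.smooth_fderiv_apply _) (h.smooth_structuralField hn))
    exact hk
  · obtain ⟨v, hv⟩ := h.exists_fderiv_eq_tangentPart hx
    have hv' : structuralField F S z R x =
        fderiv ℝ F x ((Real.sqrt (speedSq z R (S x)))⁻¹ • v) := by
      rw [map_smul, hv, h.structuralField_eq hx]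
    have := h.fderiv_inv_metric hx ((Real.sqrt (speedSq z R (S x)))⁻¹ • v)
    rw [← hv'] at this
    exact (congrArg (fderiv ℝ F x) this).trans hv'.symm

theorem fderiv_S_ne_zero (hn : 2 ≤ n) {x : Coord n} (hx : x ∈ U) {u : Coord n}
    (hu : fderiv ℝ F x u = structuralField F S z R x) :
    stretch F S z R x ≠ 0 ∧ fderiv ℝ S x u ≠ 0 := by
  have h1 := h.mink_fderiv_structuralField hx u
  rw [hu, h.mink_structuralField_self hn hx] at h1
  constructor <;> intro h0 <;> simp [h0] at h1

/-- The second fundamental form of a canal hypersurface. -/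
theorem mink_secondDerivative_unitNormal {x : Coord n} (hx : x ∈ U) (X Y : Coord n) :
    mink (fderiv ℝ (fun y => fderiv ℝ F y Y) x X) (unitNormal F S z R x) =
      (R (S x))⁻¹ * (mink (fderiv ℝ F x X) (fderiv ℝ F x Y) -
        stretch F S z R x * fderiv ℝ S x X * fderiv ℝ S x Y) := by
  have hev : (fun y => mink (unitNormal F S z R y) (fderiv ℝ F y Y)) =ᶠ[nhds x]
      fun _ => (0 : ℝ) := by
    filter_upwards [h.isOpen.mem_nhds hx] with y hy using h.mink_unitNormal_fderiv hy Y
  have hd := congrArg (fun L : Coord n →L[ℝ] ℝ => L X) hev.fderiv_eq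
  rw [fderiv_mink_apply (h.differentiableAt h.smooth_unitNormal hx)
    (h.differentiableAt (h.smooth_fderiv_apply _) hx), h.fderiv_unitNormal hx] at hd
  simp only [mink_smul_left, mink_sub_left, mink_comm (tangentPart F S z R x),
    h.mink_fderiv_tangentPart hx, fderiv_fun_const, Pi.zero_apply, zero_apply] at hd
  rw [mink_comm]
  linear_combination hd

/-- Bessel's inequality, which ensures that the arccosine defining `planeAngle` has its argument in
`[0, 1]`. -/
theorem sum_sq_le_one {x : Coord n} (hx : x ∈ U) {ξ X Y : Coord n}
    (hξ : metricAt (inducedMetric F) x ξ ξ = 1) (hXY : IsOrthonormalPair (inducedMetric F) x X Y) :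
    metricAt (inducedMetric F) x ξ X ^ 2 + metricAt (inducedMetric F) x ξ Y ^ 2 ≤ 1 := by
  obtain ⟨hX, hY, h0⟩ := hXY
  set a := metricAt (inducedMetric F) x ξ X with ha
  set b := metricAt (inducedMetric F) x ξ Y with hb
  rw [metricAt_inducedMetric] at hX hY h0 hξ ha hb
  have hnn : 0 ≤ mink (fderiv ℝ F x (ξ - a • X - b • Y)) (fderiv ℝ F x (ξ - a • X - b • Y)) := by
    by_cases hv : ξ - a • X - b • Y = 0
    · simp [hv]
    · exact (h.spacelike x hx _ hv).le
  simp only [map_sub, map_smul, mink_sub_left, mink_sub_right, mink_smul_left, mink_smul_right,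
    mink_comm (fderiv ℝ F x X) (fderiv ℝ F x ξ), mink_comm (fderiv ℝ F x Y) (fderiv ℝ F x ξ),
    mink_comm (fderiv ℝ F x Y) (fderiv ℝ F x X), hX, hY, h0, hξ, ← ha, ← hb] at hnn
  nlinarith

/-- A canal hypersurface of elliptic type is of quasi-constant sectional curvatures. -/
theorem isQuasiConstantCurvature (hn : 2 ≤ n) {ξ : Coord n → Coord n}
    (hξ : ∀ x ∈ U, fderiv ℝ F x (ξ x) = structuralField F S z R x) :
    IsQuasiConstantCurvature U (inducedMetric F) ξ := by
  intro x hx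
  set a := stretch F S z R x with ha
  set r := Real.sqrt (speedSq z R (S x)) with hr
  have hr0 : r ≠ 0 := (Real.sqrt_pos.2 (h.speedSq_pos hn hx)).ne'
  have ha0 : a ≠ 0 := (h.fderiv_S_ne_zero hn hx (hξ x hx)).1
  have hR0 := (h.R_pos _ (h.mapsTo x hx)).ne'
  -- For orthonormal `X, Y` the Gauss equation reduces to `R⁻² (a (dS(X)² + dS(Y)²) - 1)`, since the
  -- quartic terms cancel; then substitute `dS = (r / a) g(ξ, ·)`.
  refine ⟨fun θ => (r ^ 2 / a * Real.cos θ ^ 2 - 1) / R (S x) ^ 2, fun X Y hXY => ?_⟩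
  have hone : metricAt (inducedMetric F) x (ξ x) (ξ x) = 1 := by
    rw [metricAt_inducedMetric, hξ x hx, h.mink_structuralField_self hn hx]
  have hle := h.sum_sq_le_one hx hone hXY
  have hη : ∀ v, fderiv ℝ S x v = r / a * metricAt (inducedMetric F) x (ξ x) v := by
    intro v
    rw [metricAt_inducedMetric, hξ x hx, mink_comm, h.mink_fderiv_structuralField hx,
      ← ha, ← hr]
    field_simp
  obtain ⟨hX, hY, h0⟩ := hXY
  rw [metricAt_inducedMetric] at hX hY h0
  have hcos : Real.cos (planeAngle (inducedMetric F) x (ξ x) X Y) ^ 2 =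
      metricAt (inducedMetric F) x (ξ x) X ^ 2 + metricAt (inducedMetric F) x (ξ x) Y ^ 2 := by
    rw [planeAngle, Real.cos_arccos (neg_one_lt_zero.le.trans (Real.sqrt_nonneg _))
      (Real.sqrt_le_one.2 hle), Real.sq_sqrt (by positivity)]
  beta_reduce
  rw [hcos, h.gauss_equation hx (h.mink_unitNormal_self hx) (h.mink_unitNormal_fderiv hx),
    h.mink_secondDerivative_unitNormal hx, h.mink_secondDerivative_unitNormal hx,
    h.mink_secondDerivative_unitNormal hx, hX, hY, h0, hη X, hη Y, ← ha]
  field_simp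
  ring

/-- The vectors `T`, `N` and `dF(u)` are all orthogonal to `dF(v)`, so of the derivative of `T /
√(T²)` only the term with `z''` survives. -/
theorem mink_fderiv_structuralField_generator (hn : 2 ≤ n) {x : Coord n} (hx : x ∈ U)
    {u v : Coord n} (hu : fderiv ℝ F x u = structuralField F S z R x)
    (hv : fderiv ℝ S x v = 0) :
    mink (fderiv ℝ (structuralField F S z R) x u) (fderiv ℝ F x v) =
      (Real.sqrt (speedSq z R (S x)))⁻¹ * fderiv ℝ S x u *
        mink (deriv (deriv z) (S x)) (fderiv ℝ F x v) := by
  have hev : structuralField F S z R =ᶠ[nhds x]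
      fun y => (Real.sqrt (speedSq z R (S y)))⁻¹ • tangentPart F S z R y := by
    filter_upwards [h.isOpen.mem_nhds hx] with y hy using h.structuralField_eq hy
  have hT : fderiv ℝ (tangentPart F S z R) x u = fderiv ℝ S x u • deriv (deriv z) (S x) -
      (deriv R (S x) • fderiv ℝ (unitNormal F S z R) x u +
        (fderiv ℝ S x u * deriv (deriv R) (S x)) • unitNormal F S z R x) := by
    have hRd := h.differentiableAt (h.smooth_comp_param h.smooth_deriv_R) hx
    have hNd := h.differentiableAt h.smooth_unitNormal hx
    change fderiv ℝ (fun y => deriv z (S y) - deriv R (S y) • unitNormal F S z R y) x u = _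
    rw [fderiv_fun_sub (h.differentiableAt (h.smooth_comp_param h.smooth_deriv_z) hx)
      (hRd.fun_smul hNd), fderiv_fun_smul hRd hNd]
    simp [h.fderiv_comp_param h.smooth_deriv_z hx, h.fderiv_comp_param h.smooth_deriv_R hx]
  have hTv : mink (tangentPart F S z R x) (fderiv ℝ F x v) = 0 := by
    rw [mink_comm, h.mink_fderiv_tangentPart hx, hv, mul_zero]
  have huv : mink (fderiv ℝ F x u) (fderiv ℝ F x v) = 0 := by
    rw [hu, mink_comm, h.mink_fderiv_structuralField hx, hv]
    ring
  rw [hev.fderiv_eq, fderiv_fun_smul (h.differentiableAt (h.smooth_inv_sqrt_speedSq hn) hx)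
    (h.differentiableAt h.smooth_tangentPart hx)]
  simp only [add_apply, smul_apply, ContinuousLinearMap.smulRight_apply, mink_add_left,
    mink_smul_left, hTv, hT, mink_sub_left, h.mink_unitNormal_fderiv hx,
    h.fderiv_unitNormal hx, huv]
  ring

/-- The structural field is geodesic if and only if `z''` is orthogonal to the generators. -/
theorem isGeodesicField_iff_generator (hn : 2 ≤ n) {ξ : Coord n → Coord n}
    (hs : ContDiffOn ℝ ∞ ξ U) (hξ : ∀ x ∈ U, fderiv ℝ F x (ξ x) = structuralField F S z R x) :
    IsGeodesicField U (inducedMetric F) ξ ↔ ∀ x ∈ U, ∀ v, fderiv ℝ S x v = 0 →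
      mink (deriv (deriv z) (S x)) (fderiv ℝ F x v) = 0 := by
  rw [h.isGeodesicField_iff hs]
  refine forall₂_congr fun x hx => ?_
  have hev : (fun y => fderiv ℝ F y (ξ y)) =ᶠ[nhds x] structuralField F S z R := by
    filter_upwards [h.isOpen.mem_nhds hx] with y hy using hξ y hy
  rw [hev.fderiv_eq]
  have hr0 := (Real.sqrt_pos.2 (h.speedSq_pos hn hx)).ne'
  have hS := (h.fderiv_S_ne_zero hn hx (hξ x hx)).2
  refine ⟨fun hg v hv => ?_, fun hg v => ?_⟩
  · have h1 := h.mink_fderiv_structuralField_generator hn hx (hξ x hx) hv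
    rw [hg v, eq_comm, mul_eq_zero] at h1
    exact h1.resolve_left (mul_ne_zero (inv_ne_zero hr0) hS)
  -- Subtract from `v` its multiple of `ξ` to land in the generator; the `ξ` component is handled by
  -- differentiating `⟨ξ, ξ⟩ = 1`.
  · have hv' : fderiv ℝ S x (v - (fderiv ℝ S x v / fderiv ℝ S x (ξ x)) • ξ x) = 0 := by
      rw [map_sub, map_smul, smul_eq_mul, div_mul_cancel₀ _ hS, sub_self]
    have h1 := h.mink_fderiv_structuralField_generator hn hx (hξ x hx) hv'
    rw [hg _ hv', mul_zero, map_sub, map_smul, mink_sub_right, mink_smul_right, hξ x hx] at h1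
    have hunit : (fun y => mink (structuralField F S z R y) (structuralField F S z R y))
        =ᶠ[nhds x] fun _ => (1 : ℝ) := by
      filter_upwards [h.isOpen.mem_nhds hx] with y hy using h.mink_structuralField_self hn hy
    have hd := congrArg (fun L : Coord n →L[ℝ] ℝ => L (ξ x)) hunit.fderiv_eq
    have hΞ := h.differentiableAt (h.smooth_structuralField hn) hx
    rw [fderiv_mink_apply hΞ hΞ, mink_comm (structuralField F S z R x)] at hd
    simp only [fderiv_fun_const, Pi.zero_apply, zero_apply] at hd
    have h2 : mink (fderiv ℝ (structuralField F S z R) x (ξ x)) (structuralField F S z R x) = 0 := by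
      linarith
    rw [h2] at h1
    linarith

theorem isSubprojectiveOn_iff (hn : 2 ≤ n) {ξ : Coord n → Coord n}
    (hs : ContDiffOn ℝ ∞ ξ U) (hξ : ∀ x ∈ U, fderiv ℝ F x (ξ x) = structuralField F S z R x) :
    IsSubprojectiveOn U (inducedMetric F) ξ ↔ ∀ x ∈ U, ∀ v, fderiv ℝ S x v = 0 →
      mink (deriv (deriv z) (S x)) (fderiv ℝ F x v) = 0 := by
  rw [← h.isGeodesicField_iff_generator hn hs hξ]
  refine ⟨fun hsub => hsub.geodesic, fun hg => ⟨⟨h.smooth_inducedMetric,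
    fun x hx => h.posDef_inducedMetric hx, hs, fun x hx => ?_⟩,
    h.isQuasiConstantCurvature hn hξ, hg⟩⟩
  rw [metricAt_inducedMetric, hξ x hx, h.mink_structuralField_self hn hx]

end IsCanalPatch

end CanalPatch

/-! ### Orthogonality of `z''` to the generators and straightness of the curve of centers -/

section Rotational

variable {n : ℕ}

/-- The component of `z''` orthogonal to `z'`. -/
noncomputable def centerCurvature (z : ℝ → Minkowski n) (σ : ℝ) : Minkowski n :=
  deriv (deriv z) σ -
    (mink (deriv (deriv z) σ) (deriv z σ) / mink (deriv z σ) (deriv z σ)) • deriv z σ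

theorem mink_centerCurvature_deriv {z : ℝ → Minkowski n} {σ : ℝ}
    (ht : mink (deriv z σ) (deriv z σ) < 0) : mink (centerCurvature z σ) (deriv z σ) = 0 := by
  rw [centerCurvature, mink_sub_left, mink_smul_left, div_mul_cancel₀ _ ht.ne, sub_self]

namespace IsCanalPatch

variable {U : Set (Coord n)} {F : Coord n → Minkowski n} {S : Coord n → ℝ}
  {J : Set ℝ} {z : ℝ → Minkowski n} {R : ℝ → ℝ} (h : IsCanalPatch U F S J z R)
include h

theorem smooth_centerCurvature : ContDiffOn ℝ ∞ (centerCurvature z) J := by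
  have h2 : ContDiffOn ℝ ∞ (deriv (deriv z)) J :=
    h.smooth_deriv_z.deriv_of_isOpen h.isOpen_J (by simp)
  exact h2.sub (((contDiffOn_mink h2 h.smooth_deriv_z).div
    (contDiffOn_mink h.smooth_deriv_z h.smooth_deriv_z) fun σ hσ => (h.timelike σ hσ).ne).smul
      h.smooth_deriv_z)

/-- A vector orthogonal to the generator through a point lies in the plane of `t` and `N`. -/
theorem exists_eq_of_orthogonal_generator (hn : 2 ≤ n) {x : Coord n} (hx : x ∈ U)
    {y : Minkowski n} (hy : ∀ v, fderiv ℝ S x v = 0 → mink y (fderiv ℝ F x v) = 0) :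
    ∃ b c : ℝ, y = b • unitNormal F S z R x + c • deriv z (S x) := by
  obtain ⟨v, hv⟩ := h.exists_tangent_add_normal hx (h.mink_unitNormal_self hx)
    (h.mink_unitNormal_fderiv hx) y
  obtain ⟨u, hu⟩ := h.exists_fderiv_eq_tangentPart hx
  have hSu : fderiv ℝ S x u ≠ 0 := by
    intro h0
    have h1 := h.mink_fderiv_tangentPart hx u
    rw [hu, h.mink_tangentPart_self hx, h0, mul_zero] at h1
    exact (h.speedSq_pos hn hx).ne' h1
  set c := fderiv ℝ S x v / fderiv ℝ S x u
  have hv' : fderiv ℝ S x (v - c • u) = 0 := by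
    rw [map_sub, map_smul, smul_eq_mul, div_mul_cancel₀ _ hSu, sub_self]
  -- The difference `v - c u` is tangent to the generator and orthogonal to both `dF(v)` and
  -- `dF(u)`, hence to itself.
  have hvu : v = c • u := by
    by_contra hne
    have hpos := h.spacelike x hx _ (sub_ne_zero.2 hne)
    have h1 := hy _ hv'
    rw [hv, mink_sub_left, mink_smul_left, h.mink_unitNormal_fderiv hx] at h1
    have h2 : mink (fderiv ℝ F x u) (fderiv ℝ F x (v - c • u)) = 0 := by
      rw [hu, mink_comm, h.mink_fderiv_tangentPart hx, hv', mul_zero]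
    have h3 : fderiv ℝ F x (v - c • u) = fderiv ℝ F x v - c • fderiv ℝ F x u := by
      rw [map_sub, map_smul]
    nth_rewrite 1 [h3] at hpos
    rw [mink_sub_left, mink_smul_left, h2] at hpos
    linarith
  -- These are the coefficients of `c T - ⟨y, N⟩ N` after expanding `T = t - R' N`.
  refine ⟨-(c * deriv R (S x)) - mink y (unitNormal F S z R x), c, ?_⟩
  conv_lhs => rw [hv, hvu, map_smul, hu, tangentPart]
  module

/-- If `z''` is orthogonal to the generators, then it is proportional to `z'`: otherwise the
normal would be constant along the generators. -/
theorem centerCurvature_eq_zero (hn : 2 ≤ n)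
    (hg : ∀ x ∈ U, ∀ v, fderiv ℝ S x v = 0 → mink (deriv (deriv z) (S x)) (fderiv ℝ F x v) = 0)
    {x : Coord n} (hx : x ∈ U) : centerCurvature z (S x) = 0 := by
  by_contra hw0
  have horth : ∀ y ∈ U, ∀ v, fderiv ℝ S y v = 0 →
      mink (centerCurvature z (S y)) (fderiv ℝ F y v) = 0 := by
    intro y hy v hv
    rw [centerCurvature, mink_sub_left, mink_smul_left, hg y hy v hv,
      mink_comm _ (fderiv ℝ F y v), h.mink_fderiv_deriv hy, hv]
    ring
  -- `w = b N + c t` with `b ≠ 0`, because `w` is nonzero and orthogonal to `t`. Solving for `N` in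
  -- the orthogonal pair `w, t` gives scalar-product coefficients, which can be differentiated.
  have hspan : ∀ y ∈ U, centerCurvature z (S y) ≠ 0 → unitNormal F S z R y =
      (mink (unitNormal F S z R y) (centerCurvature z (S y)) /
        mink (centerCurvature z (S y)) (centerCurvature z (S y))) • centerCurvature z (S y) +
      (mink (unitNormal F S z R y) (deriv z (S y)) /
        mink (deriv z (S y)) (deriv z (S y))) • deriv z (S y) := by
    intro y hy hwy
    have ht := h.timelike _ (h.mapsTo y hy)
    have hwt := mink_centerCurvature_deriv ht
    have hww := (mink_self_pos_of_orthogonal ht hwt hwy).ne'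
    obtain ⟨b, c, hbc⟩ := h.exists_eq_of_orthogonal_generator hn hy (horth y hy)
    have hb : b ≠ 0 := by
      rintro rfl
      rw [zero_smul, zero_add] at hbc
      rw [hbc, mink_smul_left, mul_eq_zero] at hwt
      exact hwy (by rw [hbc, hwt.resolve_right ht.ne, zero_smul])
    have hN : unitNormal F S z R y = b⁻¹ • centerCurvature z (S y) - (b⁻¹ * c) • deriv z (S y) := by
      conv_rhs => rw [hbc]
      rw [smul_add, smul_smul, smul_smul, inv_mul_cancel₀ hb, one_smul, add_sub_cancel_right]
    have h1 : mink (unitNormal F S z R y) (centerCurvature z (S y)) /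
        mink (centerCurvature z (S y)) (centerCurvature z (S y)) = b⁻¹ := by
      rw [hN, mink_sub_left, mink_smul_left, mink_smul_left, mink_comm (deriv z (S y)), hwt]
      field_simp
      ring
    have h2 : mink (unitNormal F S z R y) (deriv z (S y)) /
        mink (deriv z (S y)) (deriv z (S y)) = -(b⁻¹ * c) := by
      rw [hN, mink_sub_left, mink_smul_left, mink_smul_left, hwt]
      have := ht.ne
      field_simp
      ring
    rw [h1, h2, neg_smul, ← sub_eq_add_neg]
    exact hN
  obtain ⟨v, hv, hv0⟩ := Submodule.exists_mem_ne_zero_of_ne_bot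
    (LinearMap.ker_ne_bot_of_finrank_lt (f := (fderiv ℝ S x : Coord n →ₗ[ℝ] ℝ))
      (by simp; omega))
  have hv : fderiv ℝ S x v = 0 := hv
  have ht := h.timelike _ (h.mapsTo x hx)
  have hww := (mink_self_pos_of_orthogonal ht (mink_centerCurvature_deriv ht) hw0).ne'
  have hline : HasDerivAt (fun r : ℝ => x + r • v) v 0 := by
    simpa using ((hasDerivAt_id (0 : ℝ)).smul_const v).const_add x
  have hcomp : ∀ {G : Coord n → Minkowski n}, ContDiffOn ℝ ∞ G U →
      HasDerivAt (fun r : ℝ => G (x + r • v)) (fderiv ℝ G x v) 0 := fun {G} hG => by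
    have h1 : HasFDerivAt G (fderiv ℝ G x) (x + (0 : ℝ) • v) := by
      simpa using (h.differentiableAt hG hx).hasFDerivAt
    exact h1.comp_hasDerivAt (0 : ℝ) hline
  have hN := hcomp h.smooth_unitNormal
  have hw := hcomp (h.smooth_comp_param h.smooth_centerCurvature)
  have hz := hcomp (h.smooth_comp_param h.smooth_deriv_z)
  rw [h.fderiv_comp_param h.smooth_centerCurvature hx, hv, zero_smul] at hw
  rw [h.fderiv_comp_param h.smooth_deriv_z hx, hv, zero_smul] at hz
  have hx0 : x + (0 : ℝ) • v = x := by simp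
  have horthN : ∀ y, mink (fderiv ℝ F x v) y = 0 →
      mink (fderiv ℝ (unitNormal F S z R) x v) y = 0 := fun y hy => by
    rw [h.fderiv_unitNormal hx, hv, zero_smul, zero_sub, mink_smul_left, mink_neg_left, hy]
    simp
  have hNw : mink (fderiv ℝ (unitNormal F S z R) x v) (centerCurvature z (S x)) = 0 :=
    horthN _ (by rw [mink_comm, horth x hx v hv])
  have hNt : mink (fderiv ℝ (unitNormal F S z R) x v) (deriv z (S x)) = 0 :=
    horthN _ (by rw [h.mink_fderiv_deriv hx, hv, mul_zero])
  -- Along `v` the fields `w` and `t` have zero derivative, and `dN(v)` is orthogonal to both, so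
  -- every term of the derivative of this expansion of `N` vanishes.
  have hrhs := (((hasDerivAt_mink hN hw).div (hasDerivAt_mink hw hw) (by simpa [hx0])).smul hw).add
    (((hasDerivAt_mink hN hz).div (hasDerivAt_mink hz hz) (by simpa [hx0] using ht.ne)).smul hz)
  have hev : (fun r : ℝ => unitNormal F S z R (x + r • v)) =ᶠ[nhds 0] fun r =>
      (mink (unitNormal F S z R (x + r • v)) (centerCurvature z (S (x + r • v))) /
        mink (centerCurvature z (S (x + r • v))) (centerCurvature z (S (x + r • v)))) •
          centerCurvature z (S (x + r • v)) +
      (mink (unitNormal F S z R (x + r • v)) (deriv z (S (x + r • v))) /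
        mink (deriv z (S (x + r • v))) (deriv z (S (x + r • v)))) • deriv z (S (x + r • v)) := by
    have hU : ∀ᶠ r : ℝ in nhds 0, x + r • v ∈ U :=
      hline.continuousAt.eventually_mem (by simpa using h.isOpen.mem_nhds hx)
    have hne : ∀ᶠ r : ℝ in nhds 0, centerCurvature z (S (x + r • v)) ≠ 0 :=
      hw.continuousAt.eventually_ne (by simpa using hw0)
    filter_upwards [hU, hne] with r h1 h2 using hspan _ h1 h2
  have huniq := hN.unique (hrhs.congr_of_eventuallyEq hev)
  simp only [hNw, hNt, mink_zero_right, mink_zero_left, zero_mul, mul_zero, add_zero,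
    sub_zero, zero_div, zero_smul, smul_zero] at huniq
  rw [h.fderiv_unitNormal hx, hv, zero_smul, zero_sub, smul_eq_zero, neg_eq_zero] at huniq
  have hF0 := huniq.resolve_left (inv_ne_zero (h.R_pos _ (h.mapsTo x hx)).ne')
  have := h.spacelike x hx v hv0
  simp [hF0] at this

end IsCanalPatch

/-- A time-like curve whose second derivative is proportional to the first one lies on a straight
line. -/
theorem isRotational_of_centerCurvature_eq_zero {J : Set ℝ} {z : ℝ → Minkowski n}
    (hJ : IsOpen J) (hJ' : J.OrdConnected) (hz : ContDiffOn ℝ ∞ z J)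
    (ht : ∀ σ ∈ J, mink (deriv z σ) (deriv z σ) < 0)
    (hw : ∀ σ ∈ J, centerCurvature z σ = 0) : IsRotational J z := by
  rcases J.eq_empty_or_nonempty with rfl | ⟨σ₀, hσ₀⟩
  · exact ⟨0, EuclideanSpace.single 0 1, by simp, by simp⟩
  have hd : ∀ σ ∈ J, HasDerivAt z (deriv z σ) σ := fun σ hσ =>
    ((hz.contDiffAt (hJ.mem_nhds hσ)).differentiableAt (by simp)).hasDerivAt
  have hz' : ContDiffOn ℝ ∞ (deriv z) J := hz.deriv_of_isOpen hJ (by simp)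
  have hd' : ∀ σ ∈ J, HasDerivAt (deriv z) (deriv (deriv z) σ) σ := fun σ hσ =>
    ((hz'.contDiffAt (hJ.mem_nhds hσ)).differentiableAt (by simp)).hasDerivAt
  -- The unit vector field of the curve is constant.
  have hu : ∀ σ ∈ J, HasDerivAt
      (fun τ => (Real.sqrt (-mink (deriv z τ) (deriv z τ)))⁻¹ • deriv z τ) 0 σ := by
    intro σ hσ
    have hneg : 0 < -mink (deriv z σ) (deriv z σ) := by linarith [ht σ hσ]
    have hsq := Real.sqrt_pos.2 hneg
    have h1 := ((((hasDerivAt_mink (hd' σ hσ) (hd' σ hσ)).neg.sqrt hneg.ne').inv hsq.ne').smul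
      (hd' σ hσ))
    refine h1.congr_deriv ?_
    have h2 := sub_eq_zero.1 (hw σ hσ)
    set a := mink (deriv (deriv z) σ) (deriv z σ) / mink (deriv z σ) (deriv z σ)
    have h3 : (Real.sqrt (-mink (deriv z σ) (deriv z σ))) ^ 2 = -mink (deriv z σ) (deriv z σ) :=
      Real.sq_sqrt hneg.le
    simp only [h2, mink_smul_left, mink_smul_right, Pi.neg_apply, Pi.inv_apply]
    rw [smul_smul, ← add_smul]
    convert zero_smul ℝ _ using 2
    -- With `z'' = a z'` and `r = √(-z'²)` one has `r' = a r`, so the derivative of `r⁻¹` cancels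
    -- the contribution of `z''`.
    have h4 : mink (deriv z σ) (deriv z σ) =
      -(Real.sqrt (-mink (deriv z σ) (deriv z σ))) ^ 2 := by linarith
    set r := Real.sqrt (-mink (deriv z σ) (deriv z σ))
    rw [h4]
    field_simp
    ring
  have hpre : IsPreconnected J := hJ'.isPreconnected
  set m : ℝ → ℝ := fun τ => Real.sqrt (-mink (deriv z τ) (deriv z τ)) with hm
  have hm0 : ∀ σ ∈ J, m σ ≠ 0 := fun σ hσ =>
    (Real.sqrt_pos.2 (by linarith [ht σ hσ])).ne'
  set e : Minkowski n := (m σ₀)⁻¹ • deriv z σ₀ with he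
  have hconst : ∀ σ ∈ J, deriv z σ = m σ • e := by
    intro σ hσ
    have h1 : (m σ)⁻¹ • deriv z σ = e := hJ.is_const_of_deriv_eq_zero hpre
      (fun τ hτ => (hu τ hτ).differentiableAt.differentiableWithinAt)
      (fun τ hτ => (hu τ hτ).deriv) hσ hσ₀
    rw [← h1, smul_inv_smul₀ (hm0 σ hσ)]
  have hee : mink e e ≠ 0 := by
    rw [he, mink_smul_left, mink_smul_right]
    exact mul_ne_zero (inv_ne_zero (hm0 _ hσ₀)) (mul_ne_zero (inv_ne_zero (hm0 _ hσ₀))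
      (ht _ hσ₀).ne)
  -- Removing the component of `z` along `e` leaves a constant, the base point of the line.
  have hproj : ∀ σ ∈ J, HasDerivAt (fun τ => z τ - (mink (z τ) e / mink e e) • e) 0 σ := by
    intro σ hσ
    have h1 := (hd σ hσ).sub (((hasDerivAt_mink (hd σ hσ) (hasDerivAt_const σ e)).div_const
      (mink e e)).smul_const e)
    refine h1.congr_deriv ?_
    rw [hconst σ hσ, mink_smul_left, mink_zero_right, add_zero, mul_div_cancel_right₀ _ hee, sub_self]
  obtain ⟨c, hc⟩ := hJ.exists_is_const_of_deriv_eq_zero hpre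
      (fun τ hτ => (hproj τ hτ).differentiableAt.differentiableWithinAt)
      (fun τ hτ => (hproj τ hτ).deriv)
  refine ⟨c, e, ?_, fun σ hσ => ⟨mink (z σ) e / mink e e, ?_⟩⟩
  · intro h0
    simp [h0] at hee
  · rw [← hc σ hσ, sub_add_cancel]

/-- On a time-like curve on a straight line `z''` is proportional to `z'`. -/
theorem IsRotational.exists_deriv_deriv_eq {J : Set ℝ} {z : ℝ → Minkowski n} (hr : IsRotational J z)
    (hJ : IsOpen J) (hz : ContDiffOn ℝ ∞ z J)
    (ht : ∀ σ ∈ J, mink (deriv z σ) (deriv z σ) < 0) {σ : ℝ} (hσ : σ ∈ J) :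
    ∃ a : ℝ, deriv (deriv z) σ = a • deriv z σ := by
  obtain ⟨c, v, hv, hcv⟩ := hr
  have hz' : ContDiffOn ℝ ∞ (deriv z) J := hz.deriv_of_isOpen hJ (by simp)
  let L : Submodule ℝ (Minkowski n) := Submodule.span ℝ {v}
  have hL : IsClosed (L : Set (Minkowski n)) := L.closed_of_finiteDimensional
  -- A derivative is a limit of difference quotients, and the line `L` is closed. Applied to `z` and
  -- then to `z'`, this puts `z'` and `z''` in `L`.
  have hmem : ∀ {y : ℝ → Minkowski n} {y' : Minkowski n} {τ : ℝ}, τ ∈ J → HasDerivAt y y' τ →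
      (∀ ρ ∈ J, y ρ - y τ ∈ L) → y' ∈ L := by
    intro y y' τ hτ hy hyL
    refine hL.mem_of_tendsto hy.tendsto_slope ?_
    filter_upwards [mem_nhdsWithin_of_mem_nhds (hJ.mem_nhds hτ)] with ρ hρ
    rw [slope_def_module]
    exact L.smul_mem _ (hyL ρ hρ)
  have h1 : ∀ τ ∈ J, deriv z τ ∈ L := fun τ hτ =>
    hmem hτ ((hz.contDiffAt (hJ.mem_nhds hτ)).differentiableAt (by simp)).hasDerivAt
      fun ρ hρ => by
        obtain ⟨r, hr⟩ := hcv ρ hρ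
        obtain ⟨q, hq⟩ := hcv τ hτ
        rw [hr, hq, add_sub_add_left_eq_sub, ← sub_smul]
        exact L.smul_mem _ (Submodule.mem_span_singleton_self v)
  have h2 : deriv (deriv z) σ ∈ L :=
    hmem hσ ((hz'.contDiffAt (hJ.mem_nhds hσ)).differentiableAt (by simp)).hasDerivAt
      fun ρ hρ => L.sub_mem (h1 ρ hρ) (h1 σ hσ)
  obtain ⟨p, hp⟩ := Submodule.mem_span_singleton.1 (h1 σ hσ)
  obtain ⟨q, hq⟩ := Submodule.mem_span_singleton.1 h2
  have hp0 : p ≠ 0 := by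
    rintro rfl
    have := ht σ hσ
    rw [← hp] at this
    simp at this
  exact ⟨q / p, by rw [← hp, ← hq, smul_smul, div_mul_cancel₀ _ hp0]⟩

theorem IsCanalHypersurface.isCanalPatch {M : Type*} [TopologicalSpace M]
    [ChartedSpace (Coord n) M] [IsManifold (𝓡 n) ∞ M]
    {f : M → Minkowski n} {s : M → ℝ} {J : Set ℝ} {z : ℝ → Minkowski n} {R : ℝ → ℝ}
    (hM : IsCanalHypersurface f s J z R) (hE : IsEllipticType J z)
    {φ : OpenPartialHomeomorph M (Coord n)} (hφ : φ ∈ IsManifold.maximalAtlas (𝓡 n) ∞ M) :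
    IsCanalPatch φ.target (f ∘ φ.symm) (s ∘ φ.symm) J z R where
  isOpen := φ.open_target
  smooth := contMDiffOn_iff_contDiffOn.1
    (hM.spacelikeHypersurface.smooth.comp_contMDiffOn (contMDiffOn_symm_of_mem_maximalAtlas hφ))
  spacelike := hM.spacelikeHypersurface.spacelike φ hφ
  isOpen_J := hM.isOpen_J
  mapsTo x _ := hM.range_s ▸ Set.mem_range_self (φ.symm x)
  smooth_S := contMDiffOn_iff_contDiffOn.1
    (hM.smooth_s.comp_contMDiffOn (contMDiffOn_symm_of_mem_maximalAtlas hφ))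
  regular := hM.regular_s φ hφ
  smooth_z := hM.smooth_z
  smooth_R := hM.smooth_R
  R_pos := hM.R_pos
  hypersphere x _ := hM.hypersphere (φ.symm x)
  normal := hM.normal φ hφ
  timelike := hE

end Rotational

end CanalMinkowski

/-! ### The equivalence, chart by chart -/

theorem proposition3p7 {n : ℕ} (hn : 4 ≤ n)
    {M : Type*} [TopologicalSpace M] [ChartedSpace (EuclideanSpace ℝ (Fin n)) M]
    [IsManifold (𝓡 n) ∞ M]
    (f : M → CanalMinkowski.Minkowski n) (s : M → ℝ) (J : Set ℝ)
    (z : ℝ → CanalMinkowski.Minkowski n) (R : ℝ → ℝ)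
    (hM : CanalMinkowski.IsCanalHypersurface f s J z R)
    (hE : CanalMinkowski.IsEllipticType J z) :
    CanalMinkowski.IsSubprojective f s z R ↔ CanalMinkowski.IsRotational J z := by
  have hn2 : 2 ≤ n := by omega
  constructor
  · intro hsub
    refine CanalMinkowski.isRotational_of_centerCurvature_eq_zero hM.isOpen_J hM.interval_J
      hM.smooth_z hE fun σ hσ => ?_
    -- Every parameter is attained at some point of `M`, so a chart around that point suffices to
    -- show `w = 0` there.
    obtain ⟨p, rfl⟩ : σ ∈ Set.range s := hM.range_s ▸ hσ
    have hφ := IsManifold.chart_mem_maximalAtlas (I := 𝓡 n) (n := ∞) p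
    have hP := hM.isCanalPatch hE hφ
    obtain ⟨ξ, hξ, hξs⟩ := hsub _ hφ
    have hg := (hP.isSubprojectiveOn_iff hn2 hξs.riemannian.smooth_field hξ).1 hξs
    have h0 := hP.centerCurvature_eq_zero hn2 hg (mem_chart_target _ p)
    simpa using h0
  · intro hr φ hφ
    have hP := hM.isCanalPatch hE hφ
    obtain ⟨ξ, hξs, hξ⟩ := hP.exists_smooth_field hn2
    refine ⟨ξ, hξ, (hP.isSubprojectiveOn_iff hn2 hξs hξ).2 fun x hx v hv => ?_⟩
    obtain ⟨a, ha⟩ := hr.exists_deriv_deriv_eq hM.isOpen_J hM.smooth_z hE (hP.mapsTo x hx)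
    rw [ha, CanalMinkowski.mink_smul_left, CanalMinkowski.mink_comm, hP.mink_fderiv_deriv hx, hv,
      mul_zero, mul_zero]
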